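/- **Proposition 1.3.** Let $G = \mathrm{PSL}_2(\mathbf{R})$ and $K = \mathrm{PSO}_2(\mathbf{R})$. A cocompact lattice in $G$ is a discrete subgroup $\Gamma$ such that $\Gamma\backslash G$ is compact. For such $\Gamma$, equip $\Gamma\backslash G$ with the Haar probability measure (the unique Borel probability measure invariant under right translation by $G$), and let $G$ act on $L^2(\Gamma\backslash G)$ (complex-valued functions) by the right regular representation $(hf)(x) = f(xh)$. Let $L^2(\Gamma\backslash G)^{\mathrm{fin}}$ denote the algebraic linear span of the $K$-finite vectors of the irreducible closed subrepresentations of $L^2(\Gamma\backslash G)$ (equivalently, $\bigoplus_\pi \pi^{\mathrm{fin}}$, an algebraic direct sum, for any decomposition of $L^2(\Gamma\backslash G)$ into irreducibles $\pi$, where $\pi^{\mathrm{fin}}$ is the space of $K$-finite vectors in $\pi$); its elements are smooth functions, so they can be multiplied pointwise. Let $\Gamma,\Gamma'$ be cocompact lattices in $G$, and let $\Phi \colon L^2(\Gamma\backslash G) \to L^2(\Gamma'\backslash G)$ be an isomorphism of multiplicative representations, i.e. a $G$-equivariant isometric linear isomorphism such that $\Phi(\alpha\beta) = \Phi(\alpha)\Phi(\beta)$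 for all $\alpha,\beta \in L^2(\Gamma\backslash G)^{\mathrm{fin}}$, where products are pointwise. Then there exists a unique element $g \in G/\Gamma$ such that $\Gamma' = g\Gamma g^{-1}$ and $$\Phi(f)(x) = f(g^{-1}x) \quad\text{for all } f \in L^2(\Gamma\backslash G),$$ as an equality of elements of $L^2(\Gamma'\backslash G)$ (i.e. for almost every $x \in \Gamma'\backslash G$). -/

import Mathlib

open MeasureTheory Topology
open scoped ENNReal MatrixGroups

noncomputable section

namespace MultRep

/-! ### The space of right cosets `Γ \ G` -/

section Quotient

variable {G : Type*} [Group G]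

/-- The quotient `Γ \ G` by the left multiplication action of `Γ`: the class of `x` is `Γ x`. -/
def RightQuotient (Γ : Subgroup G) : Type _ := Quotient (QuotientGroup.rightRel Γ)

namespace RightQuotient

/-- The projection `x ↦ Γ x`. -/
def mk (Γ : Subgroup G) (x : G) : RightQuotient Γ := Quotient.mk (QuotientGroup.rightRel Γ) x

theorem mk_eq_mk {Γ : Subgroup G} {x y : G} : mk Γ x = mk Γ y ↔ y * x⁻¹ ∈ Γ :=
  Quotient.eq.trans QuotientGroup.rightRel_apply

/-- Right translation `Γ x ↦ Γ x h` on `Γ \ G`. -/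
def rightMul (Γ : Subgroup G) (h : G) : RightQuotient Γ → RightQuotient Γ :=
  Quotient.map (fun x => x * h) fun x y hxy => by
    have := QuotientGroup.rightRel_apply.1 hxy
    exact QuotientGroup.rightRel_apply.2 (by simpa [mul_assoc] using this)

theorem rightMul_mk (Γ : Subgroup G) (h x : G) : rightMul Γ h (mk Γ x) = mk Γ (x * h) := rfl

theorem mk_surjective (Γ : Subgroup G) : Function.Surjective (mk Γ) := Quotient.mk_surjective

/-- Left translation `Γ' x ↦ Γ g⁻¹ x`, from `Γ' \ G` to `Γ \ G`, where `Γ' = g Γ g⁻¹`. -/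
def leftMulInv {Γ Γ' : Subgroup G} (g : G) (hg : Γ' = Γ.map (MulAut.conj g).toMonoidHom) :
    RightQuotient Γ' → RightQuotient Γ :=
  Quotient.map (fun x => g⁻¹ * x) fun x y hxy => by
    have := QuotientGroup.rightRel_apply.1 hxy
    rw [hg] at this
    obtain ⟨γ, hγ, h⟩ := this
    refine QuotientGroup.rightRel_apply.2 ?_
    have h' : g * γ * g⁻¹ = y * x⁻¹ := by simpa using h
    have : g⁻¹ * y * (g⁻¹ * x)⁻¹ = γ := by
      rw [mul_inv_rev, inv_inv, mul_assoc, ← mul_assoc y, ← h']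
      group
    rw [this]
    exact hγ

variable [TopologicalSpace G]

/-- The quotient topology on `Γ \ G`. -/
instance (Γ : Subgroup G) : TopologicalSpace (RightQuotient Γ) :=
  inferInstanceAs (TopologicalSpace (Quotient (QuotientGroup.rightRel Γ)))

/-- `Γ \ G` carries its Borel σ-algebra. -/
instance (Γ : Subgroup G) : MeasurableSpace (RightQuotient Γ) := borel _

instance (Γ : Subgroup G) : BorelSpace (RightQuotient Γ) := ⟨rfl⟩

theorem continuous_mk (Γ : Subgroup G) : Continuous (mk Γ) := continuous_quotient_mk'

theorem isOpenMap_mk [ContinuousMul G] (Γ : Subgroup G) : IsOpenMap (mk Γ) :=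
  isOpenMap_quotient_mk'_mul (Γ := Γ) (T := G)

theorem continuous_rightMul [ContinuousMul G] (Γ : Subgroup G) (h : G) :
    Continuous (rightMul Γ h) :=
  Continuous.quotient_map' (continuous_mul_const h) _

end RightQuotient

end Quotient

/-! ### Cocompact lattices and the Haar probability measure on `Γ \ G` -/

/-- A cocompact lattice: a discrete subgroup `Γ` of `G` such that `Γ \ G` is compact. -/
class IsCocompactLattice {G : Type*} [Group G] [TopologicalSpace G] (Γ : Subgroup G) : Prop where
  discrete : DiscreteTopology Γ
  compact : CompactSpace (RightQuotient Γ)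

section Haar

variable {G : Type*} [Group G] [TopologicalSpace G] [IsTopologicalGroup G]

/-- Invariance of a Borel measure on `Γ \ G` under right translation by all elements of `G`. -/
def IsRightInvariant {Γ : Subgroup G} (μ : Measure (RightQuotient Γ)) : Prop :=
  ∀ h : G, μ.map (RightQuotient.rightMul Γ h) = μ

variable [LocallyCompactSpace G] [SecondCountableTopology G]

/-- A cocompact lattice has a relatively compact Borel strict fundamental domain. -/
theorem exists_fundamentalDomain (Γ : Subgroup G) [IsCocompactLattice Γ] :
    ∃ D C : Set G, MeasurableSet[borel G] D ∧ D ⊆ C ∧ IsCompact C ∧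
      ∀ y : G, ∃! γ : Γ, γ • y ∈ D := by
  let : MeasurableSpace G := borel G
  have : BorelSpace G := ⟨rfl⟩
  have := IsCocompactLattice.discrete (Γ := Γ)
  have := IsCocompactLattice.compact (Γ := Γ)
  obtain ⟨U, hU, hU'⟩ : ∃ U ∈ 𝓝 (1 : G), ∀ γ : Γ, (γ : G) ∈ U → γ = 1 := by
    have h1 : ({1} : Set Γ) ∈ 𝓝 (1 : Γ) := (isOpen_discrete _).mem_nhds rfl
    rw [nhds_subtype_eq_comap] at h1
    obtain ⟨U, hU, h⟩ := h1
    exact ⟨U, hU, fun γ hγ => h hγ⟩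
  obtain ⟨V₀, hV₀, hV₀'⟩ := exists_nhds_split_inv hU
  obtain ⟨C₀, hC₀, hC₀'⟩ := exists_compact_mem_nhds (1 : G)
  set V : Set G := interior (V₀ ∩ C₀) with hV
  have hVo : IsOpen V := isOpen_interior
  have hV1 : (1 : G) ∈ V := mem_interior_iff_mem_nhds.2 (Filter.inter_mem hV₀ hC₀')
  have hVV : ∀ v ∈ V, ∀ w ∈ V, ∀ γ : Γ, (γ : G) = v / w → γ = 1 := fun v hv w hw γ hγ =>
    hU' γ (hγ ▸ hV₀' v (interior_subset hv).1 w (interior_subset hw).1)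
  -- the translate of `V` by `x`
  let W : G → Set G := fun x => (fun y => y * x⁻¹) ⁻¹' V
  have hWo : ∀ x, IsOpen (W x) := fun x => hVo.preimage (continuous_mul_const _)
  have hWs : ∀ x, ∀ y ∈ W x, ∀ γ : Γ, γ • y ∈ W x → γ = 1 := by
    intro x y hy γ hγ
    refine hVV _ hγ _ hy γ ?_
    simp [Subgroup.smul_def, div_eq_mul_inv, mul_assoc]
  have hWC : ∀ x, W x ⊆ (fun z => z * x) '' C₀ := fun x y hy =>
    ⟨y * x⁻¹, (interior_subset hy).2, by simp⟩
  have key : ∀ t : Finset G, ∃ D C : Set G, MeasurableSet D ∧ D ⊆ C ∧ IsCompact C ∧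
      (∀ x ∈ t, ∀ y ∈ W x, ∃ γ : Γ, γ • y ∈ D) ∧
      ∀ y ∈ D, ∀ γ : Γ, γ • y ∈ D → γ = 1 := by
    classical
    intro t
    induction t using Finset.induction_on with
    | empty => exact ⟨∅, ∅, MeasurableSet.empty, subset_rfl, isCompact_empty, by simp, by simp⟩
    | insert a t _ ih =>
      obtain ⟨D, C, hD, hDC, hC, hcov, hinj⟩ := ih
      -- the saturation of `D`
      let S : Set G := ⋃ γ : Γ, (fun y => γ • y) ⁻¹' D
      have : Countable Γ := by
        have : SecondCountableTopology Γ := inferInstance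
        exact TopologicalSpace.separableSpace_iff_countable.1 inferInstance
      have hS : MeasurableSet S := MeasurableSet.iUnion fun γ =>
        (continuous_const_smul γ).measurable hD
      have hSinv : ∀ y, ∀ γ : Γ, γ • y ∈ S → y ∈ S := by
        intro y γ h
        obtain ⟨δ, hδ⟩ := Set.mem_iUnion.1 h
        exact Set.mem_iUnion.2 ⟨δ * γ, by simpa [mul_smul] using hδ⟩
      have hDS : D ⊆ S := fun y hy => Set.mem_iUnion.2 ⟨1, by simpa using hy⟩
      refine ⟨D ∪ (W a \ S), C ∪ (fun z => z * a) '' C₀, hD.union ((hWo a).measurableSet.diff hS),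
        Set.union_subset_union hDC (Set.sdiff_subset.trans (hWC a)),
        hC.union (hC₀.image (continuous_mul_const a)), ?_, ?_⟩
      · intro x hx y hy
        rcases Finset.mem_insert.1 hx with rfl | hx
        · by_cases hyS : y ∈ S
          · obtain ⟨γ, hγ⟩ := Set.mem_iUnion.1 hyS
            exact ⟨γ, Or.inl hγ⟩
          · exact ⟨1, Or.inr ⟨by simpa using hy, by simpa using hyS⟩⟩
        · obtain ⟨γ, hγ⟩ := hcov x hx y hy
          exact ⟨γ, Or.inl hγ⟩
      · rintro y (hy | hy) γ (hγ | hγ)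
        · exact hinj y hy γ hγ
        · refine absurd ?_ hγ.2
          refine hSinv _ γ⁻¹ ?_
          simpa using hDS hy
        · exact absurd (hSinv _ γ (hDS hγ)) hy.2
        · exact hWs a y hy.1 γ hγ.1
  obtain ⟨t, ht⟩ := CompactSpace.elim_nhds_subcover
    (fun q : RightQuotient Γ =>
      RightQuotient.mk Γ '' W (Function.surjInv (RightQuotient.mk_surjective Γ) q)) (by
      intro q
      refine ((RightQuotient.isOpenMap_mk Γ) _ (hWo _)).mem_nhds ?_
      exact ⟨Function.surjInv (RightQuotient.mk_surjective Γ) q, by simpa [W] using hV1,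
        Function.surjInv_eq _ q⟩)
  classical
  obtain ⟨D, C, hD, hDC, hC, hcov, hinj⟩ :=
    key (t.image (Function.surjInv (RightQuotient.mk_surjective Γ)))
  refine ⟨D, C, hD, hDC, hC, fun y => ?_⟩
  have hex : ∃ γ : Γ, γ • y ∈ D := by
    have hy : RightQuotient.mk Γ y ∈ (⊤ : Set (RightQuotient Γ)) := trivial
    rw [← ht] at hy
    simp only [Set.mem_iUnion] at hy
    obtain ⟨q, hq, z, hz, hzy⟩ := hy
    obtain ⟨γ, hγ⟩ := hcov _ (Finset.mem_image_of_mem _ hq) z hz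
    have h1 : z * y⁻¹ ∈ Γ := RightQuotient.mk_eq_mk.1 hzy.symm
    refine ⟨γ * ⟨_, h1⟩, ?_⟩
    simpa [Subgroup.smul_def, mul_assoc] using hγ
  obtain ⟨γ, hγ⟩ := hex
  refine ⟨γ, hγ, fun δ hδ => ?_⟩
  have := hinj _ hγ (δ * γ⁻¹) (by simpa [mul_smul] using hδ)
  exact mul_inv_eq_one.1 this

/-- Existence of a `G`-invariant Borel probability measure on `Γ \ G`. -/
theorem exists_haarProb (Γ : Subgroup G) [IsCocompactLattice Γ] :
    ∃ μ : Measure (RightQuotient Γ), IsProbabilityMeasure μ ∧ IsRightInvariant μ := by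
  let : MeasurableSpace G := borel G
  have : BorelSpace G := ⟨rfl⟩
  have := IsCocompactLattice.discrete (Γ := Γ)
  have : Countable Γ := by
    have : SecondCountableTopology Γ := inferInstance
    exact TopologicalSpace.separableSpace_iff_countable.1 inferInstance
  obtain ⟨D, C, hD, hDC, hC, hDu⟩ := exists_fundamentalDomain Γ
  let ν : Measure G := Measure.haar
  have hfd : IsFundamentalDomain Γ D ν := .mk' hD.nullMeasurableSet hDu
  have hD0 : ν D ≠ 0 := hfd.measure_ne_zero (NeZero.ne ν)
  have hDtop : ν D ≠ ∞ := ((measure_mono hDC).trans_lt hC.measure_lt_top).ne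
  have hmk : Measurable (RightQuotient.mk Γ) := (RightQuotient.continuous_mk Γ).measurable
  have hprob : IsProbabilityMeasure (ProbabilityTheory.cond ν D) :=
    ProbabilityTheory.cond_isProbabilityMeasure_of_finite hD0 hDtop
  refine ⟨(ProbabilityTheory.cond ν D).map (RightQuotient.mk Γ),
    Measure.isProbabilityMeasure_map hmk.aemeasurable, fun h => ?_⟩
  have hr : Measurable (RightQuotient.rightMul Γ h) :=
    (RightQuotient.continuous_rightMul Γ h).measurable
  -- right translation multiplies `ν` by a constant `c`
  let e : G ≃ₜ G := Homeomorph.mulRight h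
  have : (ν.map (fun x => x * h)).Regular := Measure.Regular.map e
  have hmod := Measure.isMulLeftInvariant_eq_smul_of_regular (ν.map (fun x => x * h)) ν
  set c := (ν.map (fun x => x * h)).haarScalarFactor ν
  have hpre : ∀ B : Set G, MeasurableSet B → ν ((fun x => x * h) ⁻¹' B) = c * ν B := by
    intro B hB
    rw [← Measure.map_apply (measurable_mul_const h) hB, hmod]
    rfl
  have hD2m : MeasurableSet ((fun x => x * h⁻¹) ⁻¹' D) := measurable_mul_const _ hD
  have hfd2 : IsFundamentalDomain Γ ((fun x => x * h⁻¹) ⁻¹' D) ν := by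
    refine .mk' hD2m.nullMeasurableSet fun y => ?_
    have := hDu (y * h⁻¹)
    simpa [Subgroup.smul_def, mul_assoc] using this
  have hpp : ∀ B : Set G, (fun x => x * h) ⁻¹' ((fun x => x * h⁻¹) ⁻¹' B) = B := by
    intro B; ext x; simp
  have hc : (c : ℝ≥0∞) = 1 := by
    have h1 := hpre _ hD2m
    rw [hpp, ← hfd.measure_eq hfd2] at h1
    exact (ENNReal.mul_eq_right hD0 hDtop).1 h1.symm
  ext A hA
  rw [Measure.map_apply hr hA, Measure.map_apply hmk (hr hA), Measure.map_apply hmk hA,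
    ProbabilityTheory.cond_apply hD, ProbabilityTheory.cond_apply hD]
  congr 1
  have hBm : MeasurableSet (RightQuotient.mk Γ ⁻¹' A) := hmk hA
  have h2 : D ∩ RightQuotient.mk Γ ⁻¹' (RightQuotient.rightMul Γ h ⁻¹' A) =
      (fun x => x * h) ⁻¹' (RightQuotient.mk Γ ⁻¹' A ∩ (fun x => x * h⁻¹) ⁻¹' D) := by
    rw [Set.preimage_inter, hpp, Set.inter_comm]
    rfl
  rw [h2, hpre _ (hBm.inter hD2m), hc, one_mul, Set.inter_comm D]
  refine (hfd.measure_set_eq hfd2 hBm fun γ => ?_).symm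
  ext x
  have : RightQuotient.mk Γ (γ • x) = RightQuotient.mk Γ x :=
    RightQuotient.mk_eq_mk.2 (by simp [Subgroup.smul_def])
  simp only [Set.mem_preimage, this]

/-- The Haar probability measure on `Γ \ G`: the (unique) Borel probability measure on `Γ \ G` that
is invariant under right translation by `G`. -/
def haarProb (Γ : Subgroup G) [IsCocompactLattice Γ] : Measure (RightQuotient Γ) :=
  (exists_haarProb Γ).choose

instance (Γ : Subgroup G) [IsCocompactLattice Γ] : IsProbabilityMeasure (haarProb Γ) :=
  (exists_haarProb Γ).choose_spec.1

theorem isRightInvariant_haarProb (Γ : Subgroup G) [IsCocompactLattice Γ] :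
    IsRightInvariant (haarProb Γ) :=
  (exists_haarProb Γ).choose_spec.2

theorem measurePreserving_rightMul (Γ : Subgroup G) [IsCocompactLattice Γ] (h : G) :
    MeasurePreserving (RightQuotient.rightMul Γ h) (haarProb Γ) (haarProb Γ) :=
  ⟨(RightQuotient.continuous_rightMul Γ h).measurable, isRightInvariant_haarProb Γ h⟩

/-! ### The unitary representation `L²(Γ \ G)` -/

/-- The Hilbert space `L²(Γ \ G)` of complex-valued functions. -/
abbrev L2 (Γ : Subgroup G) [IsCocompactLattice Γ] : Type _ := Lp ℂ 2 (haarProb Γ)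

/-- The operator `f ↦ (x ↦ f (x h))` on `L²(Γ \ G)`. -/
def translateₗᵢ (Γ : Subgroup G) [IsCocompactLattice Γ] (h : G) : L2 Γ →ₗᵢ[ℂ] L2 Γ :=
  Lp.compMeasurePreservingₗᵢ ℂ (RightQuotient.rightMul Γ h) (measurePreserving_rightMul Γ h)

theorem translateₗᵢ_coeFn (Γ : Subgroup G) [IsCocompactLattice Γ] (h : G) (f : L2 Γ) :
    translateₗᵢ Γ h f =ᵐ[haarProb Γ] fun x => f (RightQuotient.rightMul Γ h x) :=
  Lp.coeFn_compMeasurePreserving f (measurePreserving_rightMul Γ h)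

theorem translateₗᵢ_one (Γ : Subgroup G) [IsCocompactLattice Γ] (f : L2 Γ) :
    translateₗᵢ Γ 1 f = f := by
  refine Lp.ext ((translateₗᵢ_coeFn Γ 1 f).trans (.of_forall fun x => ?_))
  obtain ⟨x, rfl⟩ := RightQuotient.mk_surjective Γ x
  simp [RightQuotient.rightMul_mk]

theorem translateₗᵢ_mul (Γ : Subgroup G) [IsCocompactLattice Γ] (g h : G) (f : L2 Γ) :
    translateₗᵢ Γ (g * h) f = translateₗᵢ Γ g (translateₗᵢ Γ h f) := by
  refine Lp.ext ((translateₗᵢ_coeFn Γ _ f).trans ?_)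
  have h1 := (measurePreserving_rightMul Γ g).quasiMeasurePreserving.ae (translateₗᵢ_coeFn Γ h f)
  filter_upwards [translateₗᵢ_coeFn Γ g (translateₗᵢ Γ h f), h1] with x hx hx'
  rw [hx, hx']
  obtain ⟨x, rfl⟩ := RightQuotient.mk_surjective Γ x
  simp [RightQuotient.rightMul_mk, mul_assoc]

/-- The right regular representation of `G` on `L²(Γ \ G)` by unitary operators:
`(h f)(x) = f (x h)`. -/
def rightRegular (Γ : Subgroup G) [IsCocompactLattice Γ] : G →* (L2 Γ ≃ₗᵢ[ℂ] L2 Γ) where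
  toFun h :=
    { toLinearEquiv := LinearEquiv.ofLinearMap (translateₗᵢ Γ h).toLinearMap
        (translateₗᵢ Γ h⁻¹).toLinearMap
        (LinearMap.ext fun f => by
          simp [← translateₗᵢ_mul, translateₗᵢ_one])
        (LinearMap.ext fun f => by
          simp [← translateₗᵢ_mul, translateₗᵢ_one])
      norm_map' := (translateₗᵢ Γ h).norm_map }
  map_one' := by
    ext1 f
    exact translateₗᵢ_one Γ f
  map_mul' g h := by
    ext1 f
    exact translateₗᵢ_mul Γ g h f

theorem rightRegular_coeFn (Γ : Subgroup G) [IsCocompactLattice Γ] (h : G) (f : L2 Γ) :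
    rightRegular Γ h f =ᵐ[haarProb Γ] fun x => f (RightQuotient.rightMul Γ h x) :=
  translateₗᵢ_coeFn Γ h f

end Haar

/-! ### The subspace `H^fin` -/

section Fin

variable {G H : Type*} [Group G] [NormedAddCommGroup H] [InnerProductSpace ℂ H]

/-- `V` is an irreducible closed subrepresentation of the unitary representation `ρ`. -/
structure IsIrreducibleSub (ρ : G →* (H ≃ₗᵢ[ℂ] H)) (V : Submodule ℂ H) : Prop where
  isClosed : IsClosed (V : Set H)
  invariant : ∀ g, ∀ v ∈ V, ρ g v ∈ V
  ne_bot : V ≠ ⊥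
  eq_bot_or_eq : ∀ W : Submodule ℂ H, W ≤ V → IsClosed (W : Set H) →
    (∀ g, ∀ w ∈ W, ρ g w ∈ W) → W = ⊥ ∨ W = V

/-- `v` is `K`-finite: its `K`-orbit spans a finite-dimensional subspace. -/
def IsKFinite (ρ : G →* (H ≃ₗᵢ[ℂ] H)) (K : Subgroup G) (v : H) : Prop :=
  FiniteDimensional ℂ (Submodule.span ℂ {w : H | ∃ k ∈ K, w = ρ k v})

/-- The subspace `H^fin`: the algebraic span of the `K`-finite vectors of the irreducible closed
subrepresentations. If `H` has discrete spectrum (so that multiplicities are finite) and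
`H = ⨁ π` is any decomposition into irreducibles, then this is the algebraic direct sum of the
spaces `π^fin` of `K`-finite vectors of the `π`: an irreducible subrepresentation is contained in
the sum of the finitely many `π` isomorphic to it. -/
def finVectors (ρ : G →* (H ≃ₗᵢ[ℂ] H)) (K : Subgroup G) : Submodule ℂ H :=
  Submodule.span ℂ {v : H | IsKFinite ρ K v ∧ ∃ V : Submodule ℂ H, IsIrreducibleSub ρ V ∧ v ∈ V}

end Fin

/-! ### `PSL₂(ℝ)` -/

instance : LocallyCompactSpace SL(2, ℝ) := by
  have : LocallyCompactSpace (Matrix (Fin 2) (Fin 2) ℝ) :=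
    inferInstanceAs (LocallyCompactSpace (Fin 2 → Fin 2 → ℝ))
  exact (Matrix.SpecialLinearGroup.isClosedEmbedding_val
    (n := Fin 2) (R := ℝ)).locallyCompactSpace

instance : SecondCountableTopology SL(2, ℝ) := by
  have : SecondCountableTopology (Matrix (Fin 2) (Fin 2) ℝ) :=
    inferInstanceAs (SecondCountableTopology (Fin 2 → Fin 2 → ℝ))
  exact (Matrix.SpecialLinearGroup.isClosedEmbedding_val
    (n := Fin 2) (R := ℝ)).isEmbedding.secondCountableTopology

instance : LocallyCompactSpace PSL(2, ℝ) := inferInstance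

instance : SecondCountableTopology PSL(2, ℝ) := inferInstance

/-- The maximal compact subgroup `PSO₂(ℝ)` of `PSL₂(ℝ)`: the image of the matrices
`A ∈ SL₂(ℝ)` with `A Aᵀ = 1`. -/
def PSO2 : Subgroup PSL(2, ℝ) :=
  Subgroup.map (QuotientGroup.mk' (Subgroup.center SL(2, ℝ)))
    { carrier := {A : SL(2, ℝ) | (A : Matrix (Fin 2) (Fin 2) ℝ) * (A : Matrix _ _ ℝ).transpose = 1}
      one_mem' := by simp
      mul_mem' := by
        intro A B hA hB
        simp only [Set.mem_ofPred_eq] at hA hB ⊢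
        rw [Matrix.SpecialLinearGroup.coe_mul, Matrix.transpose_mul, Matrix.mul_assoc,
          ← Matrix.mul_assoc _ (B : Matrix (Fin 2) (Fin 2) ℝ).transpose, hB, Matrix.one_mul, hA]
      inv_mem' := by
        intro A hA
        simp only [Set.mem_ofPred_eq] at hA ⊢
        have h1 : ((A⁻¹ : SL(2, ℝ)) : Matrix (Fin 2) (Fin 2) ℝ) =
            (A : Matrix (Fin 2) (Fin 2) ℝ).transpose := by
          have h2 : ((A⁻¹ : SL(2, ℝ)) : Matrix (Fin 2) (Fin 2) ℝ) * (A : Matrix _ _ ℝ) = 1 := by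
            rw [← Matrix.SpecialLinearGroup.coe_mul]; simp
          exact left_inv_eq_right_inv h2 hA
        rw [h1, Matrix.transpose_transpose]
        exact mul_eq_one_comm.1 hA }

/-! ### Isomorphisms of multiplicative representations -/

/-- The space `L²(Γ \ G)^fin` for `G = PSL₂(ℝ)`, the domain of multiplication. -/
def L2fin (Γ : Subgroup PSL(2, ℝ)) [IsCocompactLattice Γ] : Submodule ℂ (L2 Γ) :=
  finVectors (rightRegular Γ) PSO2

/-- `Φ : L²(Γ \ G) → L²(Γ' \ G)` is an isomorphism of multiplicative representations: a linear
isometric isomorphism, equivariant under `G`, such that `Φ (α β) = Φ α Φ β` for all `α`, `β` in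
`L²(Γ \ G)^fin`. Products are pointwise products of functions; here `γ` stands for the element `α β`
of `L²(Γ \ G)`. -/
structure IsMultRepIso {Γ Γ' : Subgroup PSL(2, ℝ)} [IsCocompactLattice Γ] [IsCocompactLattice Γ']
    (Φ : L2 Γ ≃ₗᵢ[ℂ] L2 Γ') : Prop where
  map_rep : ∀ (h : PSL(2, ℝ)) (f : L2 Γ), Φ (rightRegular Γ h f) = rightRegular Γ' h (Φ f)
  map_mul : ∀ α ∈ L2fin Γ, ∀ β ∈ L2fin Γ, ∀ γ : L2 Γ, γ =ᵐ[haarProb Γ] (fun x => α x * β x) →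
    Φ γ =ᵐ[haarProb Γ'] fun x => Φ α x * Φ β x

end MultRep

end

/-! The isomorphism is recovered from a homomorphism of commutative C*-algebras, which Gelfand
duality turns into a map of spaces.

The difficulty is that products are controlled only on `L2fin`. Let `R` be the average over `G`
against a bump function invariant under conjugation by `K`. As `Γ \ G` is compact, `R` is a compact
operator whose values are continuous functions. Eigenvectors of `R R†` with nonzero eigenvalue are
therefore continuous and `K`-finite, and those lying in irreducible subrepresentations span a dense
subspace (`IsSmoothingFamily.dense_span`). `Φ` intertwines these operators, so the images of such
vectors are continuous too. If `a` represents a vector `α` of this span and `a'` represents `Φ α`,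
multiplicativity says that `Φ` conjugates multiplication by `a` into multiplication by `a'`
(`exists_dense_intertwined`).

The continuous functions whose multiplication operator is conjugated by `Φ` into multiplication by a
continuous function form a closed, translation-invariant star subalgebra, dense in `L²`. Invariance
and density force it to separate points (`IsConjGauge.separatesPoints`), so by Stone-Weierstrass it
is all of `C(Γ \ G)` (`exists_algHom`). The resulting homomorphism into `C(Γ' \ G)` is composition
with an injective equivariant map `Γ' \ G → Γ \ G` (`exists_pointMap`), and such a map is a left
translation (`exists_eq_leftMulInv`). Density of continuous functions extends the formula to `L²`;
since they separate points, the coset is unique. -/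

set_option linter.unusedSectionVars false

noncomputable section

namespace MultRep

/-! ### Discrete spectrum and density of eigenvectors, from compact operators. -/

section Spectral

open Module.End

variable {G H : Type*} [Group G] [NormedAddCommGroup H] [InnerProductSpace ℂ H]

theorem mem_span_orthogonal {s : Set H} {v : H} :
    v ∈ (Submodule.span ℂ s)ᗮ ↔ ∀ e ∈ s, inner ℂ e v = 0 := by
  refine ⟨fun h e he => (Submodule.mem_orthogonal _ _).1 h e (Submodule.subset_span he),
    fun h => (Submodule.mem_orthogonal _ _).2 fun u hu => ?_⟩
  have : Submodule.span ℂ s ≤ (ℂ ∙ v)ᗮ := Submodule.span_le.2 fun e he =>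
    Submodule.mem_orthogonal_singleton_iff_inner_left.2 (h e he)
  exact Submodule.mem_orthogonal_singleton_iff_inner_left.1 (this hu)

/-- A closed subspace stable under the unitary representation `ρ`. -/
structure IsClosedInvariant (ρ : G →* (H ≃ₗᵢ[ℂ] H)) (V : Submodule ℂ H) : Prop where
  isClosed : IsClosed (V : Set H)
  invariant : ∀ g, ∀ v ∈ V, ρ g v ∈ V

theorem inner_unitary_left (ρ : G →* (H ≃ₗᵢ[ℂ] H)) (g : G) (v w : H) :
    inner ℂ (ρ g v) w = inner ℂ v (ρ g⁻¹ w) := by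
  rw [← (ρ g).inner_map_map v]
  congr 1
  change _ = (ρ g * ρ g⁻¹) w
  rw [← map_mul, mul_inv_cancel, map_one]
  rfl

theorem IsClosedInvariant.orthogonal {ρ : G →* (H ≃ₗᵢ[ℂ] H)} {V : Submodule ℂ H}
    (hV : IsClosedInvariant ρ V) : IsClosedInvariant ρ Vᗮ := by
  refine ⟨V.isClosed_orthogonal, fun g v hv => ?_⟩
  rw [Submodule.mem_orthogonal'] at hv ⊢
  intro u hu
  rw [inner_unitary_left]
  exact hv _ (hV.invariant _ u hu)

/-- The closed invariant subspace generated by a vector. -/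
theorem exists_isClosedInvariant_closure (ρ : G →* (H ≃ₗᵢ[ℂ] H)) (v : H) :
    ∃ V : Submodule ℂ H, IsClosedInvariant ρ V ∧ v ∈ V ∧
      ∀ W : Submodule ℂ H, IsClosedInvariant ρ W → v ∈ W → V ≤ W := by
  refine ⟨sInf {W | IsClosedInvariant ρ W ∧ v ∈ W}, ⟨?_, fun g w hw => ?_⟩, ?_, fun W hW hv => ?_⟩
  · rw [Submodule.coe_sInf]
    exact isClosed_biInter fun W hW => hW.1.isClosed
  · rw [Submodule.mem_sInf] at hw ⊢
    exact fun W hW => hW.1.invariant g w (hw W hW)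
  · exact Submodule.mem_sInf.2 fun W hW => hW.2
  · exact sInf_le ⟨hW, hv⟩

/-- The eigenvectors, with nonzero eigenvalue, of operators in `𝒯` on irreducible closed
subrepresentations of `ρ`. -/
def eigenvectors (ρ : G →* (H ≃ₗᵢ[ℂ] H)) (𝒯 : Set (H →L[ℂ] H)) : Set H :=
  {v | (∃ V : Submodule ℂ H, IsIrreducibleSub ρ V ∧ v ∈ V) ∧
    ∃ T ∈ 𝒯, ∃ l : ℂ, l ≠ 0 ∧ T v = l • v}

/-- An eigenvector with eigenvalue `l ≠ 0` is `T (l⁻¹ v)`, so it inherits whatever regularity the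
values of `T` have. -/
theorem span_eigenvectors_le {ρ : G →* (H ≃ₗᵢ[ℂ] H)} {𝒯 : Set (H →L[ℂ] H)} {W : Submodule ℂ H} (h : ∀ T ∈ 𝒯, ∀ v, T v ∈ W) :
    Submodule.span ℂ (eigenvectors ρ 𝒯) ≤ W := by
  rw [Submodule.span_le]
  rintro v ⟨-, T, hT, l, hl, hv⟩
  have := W.smul_mem l⁻¹ (h T hT v)
  rwa [hv, inv_smul_smul₀ hl] at this

variable [CompleteSpace H]

/-- A compact symmetric operator which does not vanish on a closed invariant subspace has an
eigenvector there with nonzero eigenvalue. -/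
theorem exists_eigenvector_mem {T : H →L[ℂ] H} (hT : IsCompactOperator T) (hT' : T.IsSymmetric)
    {Z : Submodule ℂ H} (hZ : IsClosed (Z : Set H)) (hTZ : ∀ z ∈ Z, T z ∈ Z)
    {z : H} (hz : z ∈ Z) (hTz : T z ≠ 0) :
    ∃ l : ℂ, l ≠ 0 ∧ ∃ v ∈ Z, v ≠ 0 ∧ T v = l • v := by
  have : CompleteSpace Z := hZ.completeSpace_coe
  let S : Z →L[ℂ] Z := T.restrict hTZ
  have hS : IsCompactOperator S := hT.restrict' hTZ
  have hS' : S.IsSymmetric := hT'.restrict_invariant hTZ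
  have h0 : S ≠ 0 := fun h => hTz <| by
    have := congrArg Subtype.val (DFunLike.congr_fun h (⟨z, hz⟩ : Z))
    exact this
  rw [Ne, ← ContinuousLinearMap.eq_zero_of_forall_hasEigenvalue_eq_zero hS hS'] at h0
  push Not at h0
  obtain ⟨l, hl, hl0⟩ := h0
  obtain ⟨v, hv⟩ := hl.exists_hasEigenvector
  refine ⟨l, hl0, v, v.2, fun h => hv.2 (Subtype.ext h), ?_⟩
  exact congrArg Subtype.val hv.apply_eq_smul

/-- A family of compact symmetric operators as obtained from a unitary representation `ρ` by
integration against functions invariant under conjugation by `K`. -/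
structure IsSmoothingFamily (ρ : G →* (H ≃ₗᵢ[ℂ] H)) (K : Subgroup G) (𝒯 : Set (H →L[ℂ] H)) :
    Prop where
  compact : ∀ T ∈ 𝒯, IsCompactOperator T
  symmetric : ∀ T ∈ 𝒯, T.IsSymmetric
  invariant : ∀ T ∈ 𝒯, ∀ V : Submodule ℂ H, IsClosedInvariant ρ V → ∀ v ∈ V, T v ∈ V
  commute : ∀ T ∈ 𝒯, ∀ k ∈ K, ∀ v, T (ρ k v) = ρ k (T v)
  faithful : ∀ v, v ≠ 0 → ∃ T ∈ 𝒯, T v ≠ 0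

variable {ρ : G →* (H ≃ₗᵢ[ℂ] H)} {K : Subgroup G} {𝒯 : Set (H →L[ℂ] H)}

/-- Every nonzero closed invariant subspace contains an irreducible one. -/
theorem IsSmoothingFamily.exists_irreducible (h𝒯 : IsSmoothingFamily ρ K 𝒯) {Z : Submodule ℂ H}
    (hZ : IsClosedInvariant ρ Z) (hZ0 : Z ≠ ⊥) : ∃ V ≤ Z, IsIrreducibleSub ρ V := by
  obtain ⟨z, hz, hz0⟩ := Submodule.exists_mem_ne_zero_of_ne_bot hZ0
  obtain ⟨T, hT, hTz⟩ := h𝒯.faithful z hz0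
  have hTc := h𝒯.compact T hT
  have hTinv := h𝒯.invariant T hT
  obtain ⟨l, hl, v₀, hv₀Z, hv₀, hTv₀⟩ := exists_eigenvector_mem hTc (h𝒯.symmetric T hT) hZ.isClosed
    (hTinv Z hZ) hz hTz
  let E : Submodule ℂ H := eigenspace T.toLinearMap l
  have hE : ∀ {w}, w ∈ E ↔ T w = l • w := mem_eigenspace_iff
  have : FiniteDimensional ℂ E := ContinuousLinearMap.finite_dimensional_eigenspace hTc l hl
  let 𝒰 : Set (Submodule ℂ H) := {U | U ≤ Z ∧ IsClosedInvariant ρ U ∧ U ⊓ E ≠ ⊥}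
  have hne : 𝒰.Nonempty :=
    ⟨Z, le_rfl, hZ, Submodule.ne_bot_iff _ |>.2 ⟨v₀, ⟨hv₀Z, hE.2 hTv₀⟩, hv₀⟩⟩
  let dim : Submodule ℂ H → ℕ := fun U => Module.finrank ℂ ↥(U ⊓ E)
  -- Among invariant subspaces meeting the finite-dimensional eigenspace `E`, take one meeting it in
  -- least dimension. Any nonzero vector of that intersection generates an irreducible subspace.
  obtain ⟨U, ⟨hUZ, hU, hUE⟩, hmin⟩ : ∃ U ∈ 𝒰, ∀ W ∈ 𝒰, dim U ≤ dim W := by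
    obtain ⟨U, hU, h⟩ := WellFounded.has_min (measure dim).wf 𝒰 hne
    exact ⟨U, hU, fun W hW => not_lt.1 (h W hW)⟩
  obtain ⟨v, ⟨hvU, hvE⟩, hv⟩ := Submodule.exists_mem_ne_zero_of_ne_bot hUE
  obtain ⟨V, hV, hvV, hVmin⟩ := exists_isClosedInvariant_closure ρ v
  have hVU : V ≤ U := hVmin U hU hvU
  refine ⟨V, hVU.trans hUZ, hV.isClosed, hV.invariant, fun h => hv (by simpa [h] using hvV), ?_⟩
  intro W hWV hWc hWi
  have hW : IsClosedInvariant ρ W := ⟨hWc, hWi⟩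
  have : CompleteSpace W := hWc.completeSpace_coe
  obtain ⟨v₁, hv₁, v₂, hv₂, hsum⟩ := W.exists_add_mem_mem_orthogonal v
  -- `T` preserves both `W` and `Wᗮ`, so the components of an eigenvector are again eigenvectors, or
  -- zero.
  have key : T v₁ = l • v₁ := by
    have h1 : T v₁ - l • v₁ ∈ W := W.sub_mem (hTinv W hW _ hv₁) (W.smul_mem _ hv₁)
    have h2 : T v₁ - l • v₁ ∈ Wᗮ := by
      have : T v₁ - l • v₁ = -(T v₂ - l • v₂) := by
        have := hE.1 hvE
        rw [hsum, map_add, smul_add] at this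
        rw [neg_sub, sub_eq_sub_iff_add_eq_add, this, add_comm]
      rw [this]
      exact Submodule.neg_mem _
        (Submodule.sub_mem _ (hTinv _ hW.orthogonal _ hv₂) (Submodule.smul_mem _ _ hv₂))
    have h3 : T v₁ - l • v₁ ∈ W ⊓ Wᗮ := ⟨h1, h2⟩
    rw [W.inf_orthogonal_eq_bot, Submodule.mem_bot] at h3
    exact sub_eq_zero.1 h3
  by_cases h0 : v₁ = 0
  · left
    have hvW : v ∈ Wᗮ := by rw [hsum, h0, zero_add]; exact hv₂
    have hWW : W ≤ W ⊓ Wᗮ := le_inf le_rfl (hWV.trans (hVmin _ hW.orthogonal hvW))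
    rwa [W.inf_orthogonal_eq_bot, le_bot_iff] at hWW
  · right
    have hWU : W ⊓ E ≤ U ⊓ E := inf_le_inf_right _ (hWV.trans hVU)
    have hW𝒰 : W ∈ 𝒰 := ⟨(hWV.trans hVU).trans hUZ, hW,
      (Submodule.ne_bot_iff _).2 ⟨v₁, ⟨hv₁, hE.2 key⟩, h0⟩⟩
    -- By minimality `W` contains all of `U ⊓ E`, in particular the generator `v` of `V`.
    have heq : W ⊓ E = U ⊓ E := Submodule.eq_of_le_of_finrank_le hWU (hmin W hW𝒰)
    have hvW : v ∈ W := (heq ▸ (⟨hvU, hvE⟩ : v ∈ U ⊓ E) : v ∈ W ⊓ E).1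
    exact le_antisymm hWV (hVmin W hW hvW)

/-- The eigenspace of the compact operator `T` is finite-dimensional, and `K`-stable because `T`
commutes with `K`. -/
theorem IsSmoothingFamily.isKFinite (h𝒯 : IsSmoothingFamily ρ K 𝒯) {v : H}
    (hv : v ∈ eigenvectors ρ 𝒯) : IsKFinite ρ K v := by
  obtain ⟨-, T, hT, l, hl, hTv⟩ := hv
  have := ContinuousLinearMap.finite_dimensional_eigenspace (h𝒯.compact T hT) l hl
  refine Submodule.finiteDimensional_of_le (S₂ := eigenspace T.toLinearMap l) ?_
  rw [Submodule.span_le]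
  rintro _ ⟨k, hk, rfl⟩
  refine mem_eigenspace_iff.2 ?_
  change T (ρ k v) = l • ρ k v
  rw [h𝒯.commute T hT k hk, hTv, map_smul]

theorem IsSmoothingFamily.span_le_finVectors (h𝒯 : IsSmoothingFamily ρ K 𝒯) :
    Submodule.span ℂ (eigenvectors ρ 𝒯) ≤ finVectors ρ K :=
  Submodule.span_mono fun _ hv => ⟨h𝒯.isKFinite hv, hv.1⟩

theorem IsSmoothingFamily.dense_span (h𝒯 : IsSmoothingFamily ρ K 𝒯) :
    Dense (Submodule.span ℂ (eigenvectors ρ 𝒯) : Set H) := by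
  rw [Submodule.dense_iff_topologicalClosure_eq_top, Submodule.topologicalClosure_eq_top_iff,
    Submodule.eq_bot_iff]
  intro w hw
  have hw' : ∀ e ∈ eigenvectors ρ 𝒯, inner ℂ e w = 0 := fun e he =>
    (Submodule.mem_orthogonal _ _).1 hw e (Submodule.subset_span he)
  -- eigenvectors are total in each irreducible subspace
  have hirr : ∀ V, IsIrreducibleSub ρ V → ∀ u ∈ V,
      (∀ e ∈ eigenvectors ρ 𝒯, e ∈ V → inner ℂ e u = 0) → u = 0 := by
    intro V hV u hu hue
    by_contra hu0
    obtain ⟨T, hT, hTu⟩ := h𝒯.faithful u hu0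
    let s : Set H := {e | e ∈ V ∧ ∃ l : ℂ, l ≠ 0 ∧ T e = l • e}
    -- On the part of `V` orthogonal to the eigenvectors of `T`, a nonzero `T` would have a further
    -- eigenvector, orthogonal to itself.
    let Z : Submodule ℂ H := V ⊓ (Submodule.span ℂ s)ᗮ
    have hZ : IsClosed (Z : Set H) := hV.isClosed.inter (Submodule.isClosed_orthogonal _)
    have hTZ : ∀ z ∈ Z, T z ∈ Z := by
      refine fun z hz => ⟨h𝒯.invariant T hT V ⟨hV.isClosed, hV.invariant⟩ z hz.1,
        mem_span_orthogonal.2 fun e he => ?_⟩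
      obtain ⟨l, -, hl⟩ := he.2
      have h1 : inner ℂ (T e) z = inner ℂ e (T z) := h𝒯.symmetric T hT e z
      rw [← h1, hl, inner_smul_left, mem_span_orthogonal.1 hz.2 e he, mul_zero]
    have huZ : u ∈ Z := ⟨hu, mem_span_orthogonal.2 fun e ⟨heV, l, hl, hTe⟩ =>
      hue e ⟨⟨V, hV, heV⟩, T, hT, l, hl, hTe⟩ heV⟩
    obtain ⟨l, hl, v, hvZ, hv, hTv⟩ := exists_eigenvector_mem (h𝒯.compact T hT)
      (h𝒯.symmetric T hT) hZ hTZ huZ hTu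
    exact hv (inner_self_eq_zero.1 (mem_span_orthogonal.1 hvZ.2 v ⟨hvZ.1, l, hl, hTv⟩))
  -- `w` is orthogonal to every irreducible subspace
  have hw'' : ∀ V, IsIrreducibleSub ρ V → w ∈ Vᗮ := by
    intro V hV
    have : CompleteSpace V := hV.isClosed.completeSpace_coe
    obtain ⟨u, hu, u', hu', hsum⟩ := V.exists_add_mem_mem_orthogonal w
    have : u = 0 := hirr V hV u hu fun e he heV => by
      have := hw' e he
      rwa [hsum, inner_add_right, Submodule.inner_right_of_mem_orthogonal heV hu',
        add_zero] at this
    rwa [hsum, this, zero_add]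
  by_contra hw0
  -- If nonzero, the common orthogonal complement of all irreducible subspaces would contain an
  -- irreducible one.
  let Z : Submodule ℂ H := sInf {U | ∃ V, IsIrreducibleSub ρ V ∧ U = Vᗮ}
  have hZ : IsClosedInvariant ρ Z := by
    refine ⟨?_, fun g z hz => ?_⟩
    · rw [Submodule.coe_sInf]
      refine isClosed_biInter ?_
      rintro _ ⟨V, -, rfl⟩
      exact V.isClosed_orthogonal
    · rw [Submodule.mem_sInf] at hz ⊢
      rintro _ ⟨V, hV, rfl⟩
      exact (IsClosedInvariant.orthogonal ⟨hV.isClosed, hV.invariant⟩).invariant g z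
        (hz _ ⟨V, hV, rfl⟩)
  have hwZ : w ∈ Z := by
    rw [Submodule.mem_sInf]
    rintro _ ⟨V, hV, rfl⟩
    exact hw'' V hV
  obtain ⟨V, hVZ, hV⟩ := h𝒯.exists_irreducible hZ fun h => hw0 (by simpa [h] using hwZ)
  have hVV : V ≤ V ⊓ Vᗮ := le_inf le_rfl (hVZ.trans (sInf_le ⟨V, hV, rfl⟩))
  rw [V.inf_orthogonal_eq_bot, le_bot_iff] at hVV
  exact hV.ne_bot hVV

end Spectral

/-! ### Topology of `Γ \ G` and comparison of its measure with Haar measure on `G`. -/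

section CompactQuotient

variable {G : Type*} [Group G]

theorem rightMul_rightMul (Γ : Subgroup G) (g h : G) (x : RightQuotient Γ) :
    RightQuotient.rightMul Γ h (RightQuotient.rightMul Γ g x) =
      RightQuotient.rightMul Γ (g * h) x := by
  obtain ⟨x, rfl⟩ := RightQuotient.mk_surjective Γ x
  simp [RightQuotient.rightMul_mk, mul_assoc]

theorem rightMul_one (Γ : Subgroup G) (x : RightQuotient Γ) :
    RightQuotient.rightMul Γ 1 x = x := by
  obtain ⟨x, rfl⟩ := RightQuotient.mk_surjective Γ x
  simp [RightQuotient.rightMul_mk]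

theorem exists_rightMul_eq (Γ : Subgroup G) (x y : RightQuotient Γ) :
    ∃ h, RightQuotient.rightMul Γ h x = y := by
  obtain ⟨x, rfl⟩ := RightQuotient.mk_surjective Γ x
  obtain ⟨y, rfl⟩ := RightQuotient.mk_surjective Γ y
  exact ⟨x⁻¹ * y, by simp [RightQuotient.rightMul_mk]⟩

variable [TopologicalSpace G] [IsTopologicalGroup G]

theorem isOpenQuotientMap_mk (Γ : Subgroup G) : IsOpenQuotientMap (RightQuotient.mk Γ) :=
  ⟨RightQuotient.mk_surjective Γ, RightQuotient.continuous_mk Γ, RightQuotient.isOpenMap_mk Γ⟩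

theorem continuous_rightMul_uncurry (Γ : Subgroup G) :
    Continuous fun p : G × RightQuotient Γ => RightQuotient.rightMul Γ p.1 p.2 := by
  have h := (IsOpenQuotientMap.id (X := G)).prodMap (isOpenQuotientMap_mk Γ)
  rw [← h.continuous_comp_iff]
  exact (RightQuotient.continuous_mk Γ).comp (continuous_snd.mul continuous_fst)

instance (Γ : Subgroup G) [h : IsCocompactLattice Γ] : CompactSpace (RightQuotient Γ) := h.compact

instance (Γ : Subgroup G) [SecondCountableTopology G] :
    SecondCountableTopology (RightQuotient Γ) :=
  (isOpenQuotientMap_mk Γ).isQuotientMap.secondCountableTopology (RightQuotient.isOpenMap_mk Γ)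

instance (Γ : Subgroup G) [T2Space G] [h : IsCocompactLattice Γ] : T2Space (RightQuotient Γ) := by
  have := h.discrete
  rw [t2Space_iff_of_isOpenQuotientMap (isOpenQuotientMap_mk Γ)]
  have hΓ : IsClosed (Γ : Set G) := Subgroup.isClosed_of_discrete
  have : {q : G × G | RightQuotient.mk Γ q.1 = RightQuotient.mk Γ q.2} =
      (fun q : G × G => q.2 * q.1⁻¹) ⁻¹' Γ := by
    ext q
    exact RightQuotient.mk_eq_mk
  rw [this]
  exact hΓ.preimage (by fun_prop)

variable [LocallyCompactSpace G] [SecondCountableTopology G]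

/-- Finitely many translates of a nonempty open set cover the compact quotient, and all have the
same measure. Hence continuous functions that agree almost everywhere are equal. -/
instance (Γ : Subgroup G) [IsCocompactLattice Γ] : (haarProb Γ).IsOpenPosMeasure := by
  refine ⟨fun U hU hne h0 => ?_⟩
  obtain ⟨y, hy⟩ := hne
  have hcont := RightQuotient.continuous_rightMul Γ
  obtain ⟨t, ht⟩ := isCompact_univ.elim_finite_subcover
    (fun h : G => RightQuotient.rightMul Γ h ⁻¹' U) (fun h => hU.preimage (hcont h)) (by
      intro x _
      obtain ⟨h, hh⟩ := exists_rightMul_eq Γ x y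
      exact Set.mem_iUnion.2 ⟨h, by simpa [hh] using hy⟩)
  have h1 : haarProb Γ (⋃ h ∈ t, RightQuotient.rightMul Γ h ⁻¹' U) = 0 := by
    refine (measure_biUnion_null_iff t.countable_toSet).2 fun h _ => ?_
    rw [(measurePreserving_rightMul Γ h).measure_preimage hU.measurableSet.nullMeasurableSet, h0]
  have h2 := measure_mono_null ht h1
  simp at h2

theorem exists_compact_mk_image (Γ : Subgroup G) [IsCocompactLattice Γ] :
    ∃ C : Set G, IsCompact C ∧ ∀ x, ∃ y ∈ C, RightQuotient.mk Γ y = x := by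
  obtain ⟨D, C, -, hDC, hC, hD⟩ := exists_fundamentalDomain Γ
  refine ⟨C, hC, fun x => ?_⟩
  obtain ⟨x, rfl⟩ := RightQuotient.mk_surjective Γ x
  obtain ⟨γ, hγ, -⟩ := hD x
  exact ⟨γ • x, hDC hγ, RightQuotient.mk_eq_mk.2 (by simp [Subgroup.smul_def])⟩

variable [MeasurableSpace G] [BorelSpace G]

theorem setLIntegral_rightMul_mk (Γ : Subgroup G) (ν : Measure G) [ν.IsMulLeftInvariant]
    (F : RightQuotient Γ → ℝ≥0∞) (x : G) {M : Set G} (hM : MeasurableSet M) :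
    ∫⁻ h in M, F (RightQuotient.rightMul Γ h (RightQuotient.mk Γ x)) ∂ν =
      ∫⁻ h in (fun h => x⁻¹ * h) ⁻¹' M, F (RightQuotient.mk Γ h) ∂ν := by
  have h1 : MeasurableSet ((fun h => x⁻¹ * h) ⁻¹' M) := measurable_const_mul _ hM
  rw [← lintegral_indicator hM, ← lintegral_indicator h1,
    ← lintegral_mul_left_eq_self (fun h => Set.indicator ((fun h => x⁻¹ * h) ⁻¹' M) _ h) x]
  refine lintegral_congr fun h => ?_
  have hmem : x * h ∈ (fun h => x⁻¹ * h) ⁻¹' M ↔ h ∈ M := by simp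
  by_cases hh : h ∈ M
  · rw [Set.indicator_of_mem hh, Set.indicator_of_mem (hmem.2 hh), RightQuotient.rightMul_mk]
  · rw [Set.indicator_of_notMem hh, Set.indicator_of_notMem (mt hmem.1 hh)]

open Pointwise in
/-- Integrals over a compact piece of an orbit are controlled by the integral over `Γ \ G`. -/
theorem exists_setLIntegral_rightMul_le (Γ : Subgroup G) [IsCocompactLattice Γ] (ν : Measure G)
    [ν.IsHaarMeasure] {M : Set G} (hM : IsCompact M) (hMm : MeasurableSet M) :
    ∃ N : ℝ≥0∞, N ≠ ∞ ∧ ∀ F : RightQuotient Γ → ℝ≥0∞, Continuous F → ∀ x,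
      ∫⁻ h in M, F (RightQuotient.rightMul Γ h x) ∂ν ≤ N * ∫⁻ y, F y ∂(haarProb Γ) := by
  obtain ⟨C, hC, hCs⟩ := exists_compact_mk_image Γ
  -- For `x`, `y` in `C` one has `x M = y (y⁻¹ x) M ⊆ y M'`. The integral over the piece at `x` is
  -- thus bounded by the one over the larger piece at any `y`, and then by its mean over `y`. The
  -- closure makes `M'` measurable.
  let M' : Set G := closure (C⁻¹ * C * M)
  have hM' : IsCompact M' := ((hC.inv.mul hC).mul hM).closure
  have hM'm : MeasurableSet M' := isClosed_closure.measurableSet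
  refine ⟨ν M', hM'.measure_lt_top.ne, fun F hF x => ?_⟩
  have key : ∀ y, ∫⁻ h in M, F (RightQuotient.rightMul Γ h x) ∂ν ≤
      ∫⁻ h in M', F (RightQuotient.rightMul Γ h y) ∂ν := by
    intro y
    obtain ⟨x, hx, rfl⟩ := hCs x
    obtain ⟨y, hy, rfl⟩ := hCs y
    rw [setLIntegral_rightMul_mk Γ ν F x hMm, setLIntegral_rightMul_mk Γ ν F y hM'm]
    refine lintegral_mono_set fun h hh => subset_closure ?_
    exact ⟨y⁻¹ * x, ⟨y⁻¹, Set.inv_mem_inv.2 hy, x, hx, rfl⟩, x⁻¹ * h, hh, by simp [mul_assoc]⟩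
  have hFm : Measurable F := hF.measurable
  calc ∫⁻ h in M, F (RightQuotient.rightMul Γ h x) ∂ν
      = ∫⁻ _y, ∫⁻ h in M, F (RightQuotient.rightMul Γ h x) ∂ν ∂(haarProb Γ) := by simp
    _ ≤ ∫⁻ y, ∫⁻ h in M', F (RightQuotient.rightMul Γ h y) ∂ν ∂(haarProb Γ) :=
        lintegral_mono key
    _ = ∫⁻ h in M', ∫⁻ y, F (RightQuotient.rightMul Γ h y) ∂(haarProb Γ) ∂ν := by
        refine lintegral_lintegral_swap (Continuous.aemeasurable ?_)
        exact hF.comp ((continuous_rightMul_uncurry Γ).comp continuous_swap)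
    _ = ∫⁻ _h in M', ∫⁻ y, F y ∂(haarProb Γ) ∂ν := by
        refine lintegral_congr fun h => ?_
        exact (measurePreserving_rightMul Γ h).lintegral_comp hFm
    _ = ν M' * ∫⁻ y, F y ∂(haarProb Γ) := by simp [mul_comm]

/-- Integrate the indicator of `E` at `x h` over both `x` and `h`: left invariance of `ν` evaluates
one order, right invariance of `haarProb` the other. If `ν` is infinite this still identifies the
null sets, which is its use. -/
theorem measure_preimage_mk (Γ : Subgroup G) [IsCocompactLattice Γ] (ν : Measure G)
    [ν.IsHaarMeasure] {E : Set (RightQuotient Γ)} (hE : MeasurableSet E) :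
    ν (RightQuotient.mk Γ ⁻¹' E) = ν Set.univ * haarProb Γ E := by
  have hmk := (RightQuotient.continuous_mk Γ).measurable
  have key : ∀ x, ∫⁻ h, E.indicator 1 (RightQuotient.rightMul Γ h x) ∂ν =
      ν (RightQuotient.mk Γ ⁻¹' E) := by
    intro x
    obtain ⟨x, rfl⟩ := RightQuotient.mk_surjective Γ x
    have := lintegral_mul_left_eq_self (μ := ν)
      (fun h => E.indicator (1 : RightQuotient Γ → ℝ≥0∞) (RightQuotient.mk Γ h)) x
    simp only [RightQuotient.rightMul_mk]
    rw [this, ← lintegral_indicator_one (hmk hE)]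
    rfl
  calc ν (RightQuotient.mk Γ ⁻¹' E)
      = ∫⁻ x, ∫⁻ h, E.indicator 1 (RightQuotient.rightMul Γ h x) ∂ν ∂(haarProb Γ) := by simp [key]
    _ = ∫⁻ h, ∫⁻ x, E.indicator 1 (RightQuotient.rightMul Γ h x) ∂(haarProb Γ) ∂ν := by
        refine lintegral_lintegral_swap (Measurable.aemeasurable ?_)
        exact (measurable_one.indicator hE).comp
          ((continuous_rightMul_uncurry Γ).comp continuous_swap).measurable
    _ = ∫⁻ _h, haarProb Γ E ∂ν := by
        refine lintegral_congr fun h => ?_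
        rw [(measurePreserving_rightMul Γ h).lintegral_comp (measurable_one.indicator hE),
          lintegral_indicator_one hE]
    _ = ν Set.univ * haarProb Γ E := by simp [mul_comm]

end CompactQuotient

/-! ### Left translations between the two quotients. -/

section LeftTranslation

variable {G : Type*} [Group G]

theorem mem_map_conj {Γ : Subgroup G} {g x : G} :
    x ∈ Γ.map (MulAut.conj g).toMonoidHom ↔ g⁻¹ * x * g ∈ Γ :=
  Subgroup.mem_map_equiv (f := MulAut.conj g)

variable [TopologicalSpace G] [IsTopologicalGroup G] [LocallyCompactSpace G]
  [SecondCountableTopology G]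

theorem continuous_leftMulInv {Γ Γ' : Subgroup G} {g : G}
    (hg : Γ' = Γ.map (MulAut.conj g).toMonoidHom) :
    Continuous (RightQuotient.leftMulInv g hg) := by
  rw [← (isOpenQuotientMap_mk Γ').continuous_comp_iff]
  exact (RightQuotient.continuous_mk Γ).comp (continuous_const_mul g⁻¹)

/-- Null sets are compared upstairs in `G`, where translation by `g⁻¹` preserves Haar measure. -/
theorem quasiMeasurePreserving_leftMulInv {Γ Γ' : Subgroup G} [IsCocompactLattice Γ]
    [IsCocompactLattice Γ'] {g : G} (hg : Γ' = Γ.map (MulAut.conj g).toMonoidHom) :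
    Measure.QuasiMeasurePreserving (RightQuotient.leftMulInv g hg) (haarProb Γ') (haarProb Γ) := by
  let : MeasurableSpace G := borel G
  have : BorelSpace G := ⟨rfl⟩
  let ν : Measure G := Measure.haar
  have hl := (continuous_leftMulInv hg).measurable
  refine ⟨hl, Measure.AbsolutelyContinuous.mk fun E hE h0 => ?_⟩
  rw [Measure.map_apply hl hE]
  have h1 : ν (RightQuotient.mk Γ' ⁻¹' (RightQuotient.leftMulInv g hg ⁻¹' E)) =
      ν (RightQuotient.mk Γ ⁻¹' E) := measure_preimage_mul ν g⁻¹ (RightQuotient.mk Γ ⁻¹' E)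
  rw [measure_preimage_mk Γ ν hE, h0, mul_zero, measure_preimage_mk Γ' ν (hl hE)] at h1
  exact (mul_eq_zero.1 h1).resolve_left (NeZero.ne (ν Set.univ))

end LeftTranslation

/-! ### Averaging operators: compactness, and continuity of their values. -/

section Smoothing

open scoped CompactlySupported

variable {G : Type*} [Group G] [TopologicalSpace G] [IsTopologicalGroup G]

section Translation

variable (Γ : Subgroup G)

/-- The translates `x ↦ f (x h)` of a continuous function, depending continuously on `h`. -/
def translateC (f : C(RightQuotient Γ, ℂ)) : C(G, C(RightQuotient Γ, ℂ)) :=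
  ContinuousMap.curry ⟨fun p => f (RightQuotient.rightMul Γ p.1 p.2),
    f.continuous.comp (continuous_rightMul_uncurry Γ)⟩

@[simp]
theorem translateC_apply (f : C(RightQuotient Γ, ℂ)) (h : G) (x : RightQuotient Γ) :
    translateC Γ f h x = f (RightQuotient.rightMul Γ h x) := rfl

end Translation

variable [LocallyCompactSpace G] [SecondCountableTopology G] [T2Space G]

section

variable (Γ : Subgroup G) [IsCocompactLattice Γ]

/-- The class in `L²(Γ \ G)` of a continuous function. -/
abbrev toL2 : C(RightQuotient Γ, ℂ) →L[ℂ] L2 Γ := ContinuousMap.toLp 2 (haarProb Γ) ℂ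

theorem denseRange_toL2 : DenseRange (toL2 Γ) :=
  ContinuousMap.toLp_denseRange ℂ (haarProb Γ) ℂ (by simp)

theorem toL2_injective : Function.Injective (toL2 Γ) := ContinuousMap.toLp_injective _

theorem toL2_translateC (f : C(RightQuotient Γ, ℂ)) (h : G) :
    toL2 Γ (translateC Γ f h) = rightRegular Γ h (toL2 Γ f) := by
  refine Lp.ext ((ContinuousMap.coeFn_toLp _ _).trans ?_)
  have h1 := (measurePreserving_rightMul Γ h).quasiMeasurePreserving.ae
    (ContinuousMap.coeFn_toLp (p := 2) (𝕜 := ℂ) (haarProb Γ) f)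
  filter_upwards [rightRegular_coeFn Γ h (toL2 Γ f), h1] with x hx hx'
  rw [hx, hx', translateC_apply]

theorem continuous_rightRegular (f : L2 Γ) : Continuous fun h => rightRegular Γ h f := by
  let g : G → C(RightQuotient Γ, RightQuotient Γ) := ContinuousMap.curry
    ⟨fun p => RightQuotient.rightMul Γ p.1 p.2, continuous_rightMul_uncurry Γ⟩
  have hg : Continuous g := map_continuous _
  exact Continuous.compMeasurePreservingLp (f := fun _ => f) continuous_const hg
    (measurePreserving_rightMul Γ) (by simp)

variable [MeasurableSpace G] [BorelSpace G] (ν : Measure G) [ν.IsHaarMeasure]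
  (φ : C_c(G, ℂ))

theorem integrable_smul {E : Type*} [NormedAddCommGroup E] [NormedSpace ℂ E]
    {u : G → E} (hu : Continuous u) : Integrable (fun h => φ h • u h) ν := by
  refine Continuous.integrable_of_hasCompactSupport ?_ ?_
  · have := φ.continuous
    fun_prop
  · refine φ.hasCompactSupport.mono fun h hh => ?_
    contrapose hh
    simp only [Function.mem_support, not_not] at hh ⊢
    simp [hh]

/-- The operator `f ↦ ∫ φ(h) (h f) dh` on `L²(Γ \ G)`. -/
def average : L2 Γ →L[ℂ] L2 Γ :=
  LinearMap.mkContinuous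
    { toFun := fun f => ∫ h, φ h • rightRegular Γ h f ∂ν
      map_add' := fun f g => by
        rw [← integral_add (integrable_smul ν φ (continuous_rightRegular Γ f))
          (integrable_smul ν φ (continuous_rightRegular Γ g))]
        simp
      map_smul' := fun c f => by
        rw [RingHom.id_apply, ← integral_smul]
        simp [smul_comm c] }
    (∫ h, ‖φ h‖ ∂ν) fun f => by
      refine (norm_integral_le_integral_norm _).trans (le_of_eq ?_)
      rw [← integral_mul_const]
      simp [norm_smul]

theorem average_apply (f : L2 Γ) :
    average Γ ν φ f = ∫ h, φ h • rightRegular Γ h f ∂ν := rfl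

/-- The operator `f ↦ ∫ φ(h) (h f) dh` on continuous functions. -/
def averageC (f : C(RightQuotient Γ, ℂ)) : C(RightQuotient Γ, ℂ) :=
  ∫ h, φ h • translateC Γ f h ∂ν

theorem averageC_apply (f : C(RightQuotient Γ, ℂ)) (x : RightQuotient Γ) :
    averageC Γ ν φ f x = ∫ h, φ h * f (RightQuotient.rightMul Γ h x) ∂ν := by
  have := (ContinuousMap.evalCLM ℂ x).integral_comp_comm
    (integrable_smul ν φ (translateC Γ f).continuous)
  exact this.symm

theorem averageC_sub (f g : C(RightQuotient Γ, ℂ)) :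
    averageC Γ ν φ (f - g) = averageC Γ ν φ f - averageC Γ ν φ g := by
  rw [averageC, averageC, averageC, ← integral_sub
    (integrable_smul ν φ (translateC Γ f).continuous)
    (integrable_smul ν φ (translateC Γ g).continuous)]
  refine integral_congr_ae (.of_forall fun h => ?_)
  ext x
  simp [mul_sub]

theorem average_toL2 (f : C(RightQuotient Γ, ℂ)) :
    average Γ ν φ (toL2 Γ f) = toL2 Γ (averageC Γ ν φ f) := by
  rw [average_apply, averageC, ← (toL2 Γ).integral_comp_comm
    (integrable_smul ν φ (translateC Γ f).continuous)]
  simp [toL2_translateC]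

/-- Since `V = Vᗮᗮ`, it suffices to pair with `u ∈ Vᗮ`, where the integrand vanishes pointwise. -/
theorem average_mem {V : Submodule ℂ (L2 Γ)} (hV : IsClosedInvariant (rightRegular Γ) V)
    {v : L2 Γ} (hv : v ∈ V) : average Γ ν φ v ∈ V := by
  have : CompleteSpace V := hV.isClosed.completeSpace_coe
  rw [← V.orthogonal_orthogonal, Submodule.mem_orthogonal]
  intro u hu
  rw [average_apply, ← integral_inner (integrable_smul ν φ (continuous_rightRegular Γ v))]
  refine integral_eq_zero_of_ae (.of_forall fun h => ?_)
  simp [inner_smul_right, Submodule.inner_left_of_mem_orthogonal (hV.invariant h v hv) hu]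

theorem lintegral_enorm_le_enorm_toL2 (f : C(RightQuotient Γ, ℂ)) :
    ∫⁻ y, ‖f y‖ₑ ∂(haarProb Γ) ≤ ‖toL2 Γ f‖ₑ := by
  rw [← eLpNorm_one_eq_lintegral_enorm, Lp.enorm_def,
    eLpNorm_congr_ae (ContinuousMap.coeFn_toLp _ f)]
  exact eLpNorm_le_eLpNorm_of_exponent_le (by norm_num) f.continuous.aestronglyMeasurable

/-- A sup-norm bound by the `L²` norm, with `N` depending only on `M`. It is applied with `w = φ`
for boundedness and with `w` a difference of translates of `φ` for equicontinuity. -/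
theorem exists_norm_integral_le {M : Set G} (hM : IsCompact M) :
    ∃ N : ℝ, 0 ≤ N ∧ ∀ (f : C(RightQuotient Γ, ℂ)) (x : RightQuotient Γ) (w : G → ℂ) (η : ℝ),
      (∀ h, ‖w h‖ ≤ η) → (∀ h ∉ M, w h = 0) →
      ‖∫ h, w h * f (RightQuotient.rightMul Γ h x) ∂ν‖ ≤ η * N * ‖toL2 Γ f‖ := by
  obtain ⟨N, hN, hle⟩ := exists_setLIntegral_rightMul_le Γ ν hM hM.isClosed.measurableSet
  refine ⟨N.toReal, ENNReal.toReal_nonneg, fun f x w η hη hw => ?_⟩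
  have hη0 : 0 ≤ η := (norm_nonneg _).trans (hη 1)
  have key : ‖∫ h, w h * f (RightQuotient.rightMul Γ h x) ∂ν‖ₑ ≤
      ENNReal.ofReal η * N * ‖toL2 Γ f‖ₑ := by
    calc ‖∫ h, w h * f (RightQuotient.rightMul Γ h x) ∂ν‖ₑ
        ≤ ∫⁻ h, ‖w h * f (RightQuotient.rightMul Γ h x)‖ₑ ∂ν := enorm_integral_le_lintegral_enorm _
      _ ≤ ∫⁻ h, M.indicator (fun h => ENNReal.ofReal η * ‖f (RightQuotient.rightMul Γ h x)‖ₑ) h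
            ∂ν := by
          refine lintegral_mono fun h => ?_
          by_cases hh : h ∈ M
          · rw [Set.indicator_of_mem hh, enorm_mul]
            gcongr
            rw [← ofReal_norm]
            exact ENNReal.ofReal_le_ofReal (hη h)
          · simp [hw h hh]
      _ = ENNReal.ofReal η * ∫⁻ h in M, ‖f (RightQuotient.rightMul Γ h x)‖ₑ ∂ν := by
          rw [lintegral_indicator hM.isClosed.measurableSet,
            lintegral_const_mul' _ _ ENNReal.ofReal_ne_top]
      _ ≤ ENNReal.ofReal η * (N * ∫⁻ y, ‖f y‖ₑ ∂(haarProb Γ)) := by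
          gcongr
          exact hle (fun y => ‖f y‖ₑ) f.continuous.enorm x
      _ ≤ ENNReal.ofReal η * N * ‖toL2 Γ f‖ₑ := by
          rw [mul_assoc]
          gcongr
          exact lintegral_enorm_le_enorm_toL2 Γ f
  have h2 := ENNReal.toReal_mono (by finiteness) key
  simpa [ENNReal.toReal_mul, ENNReal.toReal_ofReal hη0] using h2

theorem exists_norm_averageC_le : ∃ N : ℝ, ∀ (f : C(RightQuotient Γ, ℂ)) (x : RightQuotient Γ),
    ‖averageC Γ ν φ f x‖ ≤ N * ‖toL2 Γ f‖ := by
  obtain ⟨N, -, hN⟩ := exists_norm_integral_le Γ ν φ.hasCompactSupport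
  obtain ⟨η, hη⟩ := φ.hasCompactSupport.exists_bound_of_continuous φ.continuous
  refine ⟨η * N, fun f x => ?_⟩
  rw [averageC_apply]
  exact hN f x φ η hη fun h hh => image_eq_zero_of_notMem_tsupport hh

open Pointwise in
-- Left invariance of `ν` moves the translation by `g` from `f` to `φ`, and `φ` is uniformly
-- continuous. The bound depends on `f` only through its `L²` norm.
theorem eventually_norm_averageC_sub_le {ε : ℝ} (hε : 0 < ε) :
    ∀ᶠ g in 𝓝 (1 : G), ∀ (f : C(RightQuotient Γ, ℂ)) (x : RightQuotient Γ),
      ‖averageC Γ ν φ f (RightQuotient.rightMul Γ g x) - averageC Γ ν φ f x‖ ≤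
        ε * ‖toL2 Γ f‖ := by
  obtain ⟨V, hV, hV1⟩ := exists_compact_mem_nhds (1 : G)
  let M : Set G := V * tsupport φ
  have hM : IsCompact M := hV.mul φ.hasCompactSupport
  have : CompactSpace M := isCompact_iff_compactSpace.1 hM
  obtain ⟨N, hN0, hN⟩ := exists_norm_integral_le Γ ν hM
  -- Continuity of the curried map at `1` is uniform convergence on `M`, which contains the supports
  -- of `φ` and of its translates by `V`.
  let F : C(G, C(M, ℂ)) := ContinuousMap.curry
    ⟨fun p => φ (p.1⁻¹ * p.2), φ.continuous.comp (by fun_prop)⟩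
  have hη : 0 < ε / (N + 1) := by positivity
  have hF : ∀ᶠ g in 𝓝 (1 : G), dist (F g) (F 1) < ε / (N + 1) :=
    Metric.tendsto_nhds.1 (F.continuous.tendsto 1) _ hη
  filter_upwards [hV1, hF] with g hgV hg f x
  have hint : ∀ y, Integrable (fun h => φ h * f (RightQuotient.rightMul Γ h y)) ν := fun y =>
    integrable_smul ν φ (f.continuous.comp
      ((continuous_rightMul_uncurry Γ).comp (Continuous.prodMk_left y)))
  have h1 := (hint (RightQuotient.rightMul Γ g x)).comp_mul_left g⁻¹
  rw [averageC_apply, averageC_apply,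
    ← integral_mul_left_eq_self (fun h => φ h * f (RightQuotient.rightMul Γ h _)) g⁻¹,
    ← integral_sub h1 (hint x)]
  have h2 : ∀ h, φ (g⁻¹ * h) * f (RightQuotient.rightMul Γ (g⁻¹ * h)
      (RightQuotient.rightMul Γ g x)) - φ h * f (RightQuotient.rightMul Γ h x) =
      (φ (g⁻¹ * h) - φ h) * f (RightQuotient.rightMul Γ h x) := by
    intro h
    rw [rightMul_rightMul, mul_inv_cancel_left, sub_mul]
  simp_rw [h2]
  have hout : ∀ h ∉ M, φ (g⁻¹ * h) - φ h = 0 := by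
    intro h hh
    have h3 : φ h = 0 := image_eq_zero_of_notMem_tsupport fun hs =>
      hh ⟨1, mem_of_mem_nhds hV1, h, hs, one_mul h⟩
    have h4 : φ (g⁻¹ * h) = 0 := image_eq_zero_of_notMem_tsupport fun hs =>
      hh ⟨g, hgV, _, hs, mul_inv_cancel_left g h⟩
    rw [h3, h4, sub_zero]
  refine (hN f x _ (ε / (N + 1)) (fun h => ?_) hout).trans ?_
  · by_cases hh : h ∈ M
    · have := (ContinuousMap.dist_apply_le_dist (f := F g) (g := F 1) ⟨h, hh⟩).trans hg.le
      simpa [F, dist_eq_norm] using this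
    · rw [hout h hh, norm_zero]
      exact hη.le
  · gcongr
    rw [div_mul_eq_mul_div, div_le_iff₀ (by positivity)]
    nlinarith

/-- Arzelà-Ascoli on averages of continuous functions. The set `Q`, compact for the sup norm, yields
both compactness of `average` and continuity of its values. -/
theorem exists_isCompact_average : ∃ Q : Set C(RightQuotient Γ, ℂ), IsCompact Q ∧
    ∀ v : L2 Γ, ‖v‖ ≤ 1 → ∃ q ∈ Q, toL2 Γ q = average Γ ν φ v := by
  let e := ContinuousMap.linearIsometryBoundedOfCompact (RightQuotient Γ) ℂ ℂ
  -- Radius `2` gives an open ball around the closed unit ball, so every `v` with `‖v‖ ≤ 1` is a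
  -- limit of elements of `B`.
  let B : Set C(RightQuotient Γ, ℂ) := {f | ‖toL2 Γ f‖ < 2}
  let A : Set (BoundedContinuousFunction (RightQuotient Γ) ℂ) :=
    (fun f => e (averageC Γ ν φ f)) '' B
  obtain ⟨N, hN⟩ := exists_norm_averageC_le Γ ν φ
  have hA : IsCompact (closure A) := by
    refine BoundedContinuousFunction.arzela_ascoli (Metric.closedBall 0 (|N| * 2))
      (isCompact_closedBall _ _) A ?_ ?_
    · rintro _ x ⟨f, hf, rfl⟩
      rw [mem_closedBall_zero_iff]
      refine (hN f x).trans ?_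
      have : ‖toL2 Γ f‖ ≤ 2 := le_of_lt hf
      gcongr
      exact le_abs_self N
    · intro x
      rw [Metric.equicontinuousAt_iff_right]
      intro ε hε
      obtain ⟨x, rfl⟩ := RightQuotient.mk_surjective Γ x
      have h1 := eventually_norm_averageC_sub_le Γ ν φ (half_pos (half_pos hε))
      have h2 : ∀ᶠ y in 𝓝 x, ∀ (f : C(RightQuotient Γ, ℂ)) (z : RightQuotient Γ),
          ‖averageC Γ ν φ f (RightQuotient.rightMul Γ (x⁻¹ * y) z) - averageC Γ ν φ f z‖ ≤
            ε / 2 / 2 * ‖toL2 Γ f‖ := by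
        have : Filter.Tendsto (fun y => x⁻¹ * y) (𝓝 x) (𝓝 1) := by
          have : Continuous fun y => x⁻¹ * y := continuous_const_mul _
          simpa using this.tendsto x
        exact this.eventually h1
      rw [← (isOpenQuotientMap_mk Γ).map_nhds_eq x, Filter.eventually_map]
      filter_upwards [h2] with y hy
      rintro ⟨_, f, hf, rfl⟩
      have h3 := hy f (RightQuotient.mk Γ x)
      rw [RightQuotient.rightMul_mk, mul_inv_cancel_left] at h3
      have h4 : ‖toL2 Γ f‖ < 2 := hf
      rw [dist_comm, dist_eq_norm]
      refine lt_of_le_of_lt h3 ?_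
      nlinarith
  refine ⟨e ⁻¹' closure A, ?_, fun v hv => ?_⟩
  · exact ((ContinuousMap.isometryEquivBoundedOfCompact (RightQuotient Γ)
      ℂ).toHomeomorph.isClosedEmbedding.isCompact_preimage hA)
  · have hQ : IsCompact (e ⁻¹' closure A) :=
      (ContinuousMap.isometryEquivBoundedOfCompact (RightQuotient Γ)
        ℂ).toHomeomorph.isClosedEmbedding.isCompact_preimage hA
    -- The image of `Q` in `L²` is compact, hence closed, so limits of averages still have
    -- representatives in `Q`.
    have hcl : IsClosed (toL2 Γ '' (e ⁻¹' closure A)) := (hQ.image (toL2 Γ).continuous).isClosed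
    have hv2 : v ∈ closure (Metric.ball 0 2 ∩ Set.range (toL2 Γ)) :=
      (denseRange_toL2 Γ).open_subset_closure_inter Metric.isOpen_ball
        (mem_ball_zero_iff.2 (hv.trans_lt one_lt_two))
    have h3 := map_mem_closure (average Γ ν φ).continuous hv2
      (t := toL2 Γ '' (e ⁻¹' closure A)) (by
        rintro _ ⟨hf, f, rfl⟩
        rw [average_toL2]
        exact ⟨_, subset_closure ⟨f, mem_ball_zero_iff.1 hf, rfl⟩, rfl⟩)
    rw [hcl.closure_eq] at h3
    exact h3

theorem isCompactOperator_average : IsCompactOperator (average Γ ν φ) := by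
  obtain ⟨Q, hQ, h⟩ := exists_isCompact_average Γ ν φ
  refine ⟨toL2 Γ '' Q, hQ.image (toL2 Γ).continuous, ?_⟩
  filter_upwards [Metric.closedBall_mem_nhds (0 : L2 Γ) one_pos] with v hv
  exact h v (mem_closedBall_zero_iff.1 hv)

theorem exists_toL2_eq_average (v : L2 Γ) : ∃ q, toL2 Γ q = average Γ ν φ v := by
  obtain ⟨Q, -, h⟩ := exists_isCompact_average Γ ν φ
  by_cases hv : v = 0
  · exact ⟨0, by simp [hv]⟩
  have hv' : (‖v‖ : ℂ) ≠ 0 := by simpa using hv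
  obtain ⟨q, -, hq⟩ := h ((‖v‖ : ℂ)⁻¹ • v) (by
    rw [norm_smul, norm_inv, Complex.norm_real, norm_norm, inv_mul_cancel₀ (by simpa using hv)])
  refine ⟨(‖v‖ : ℂ) • q, ?_⟩
  rw [map_smul, hq, map_smul, smul_inv_smul₀ hv']

end

end Smoothing

/-! ### Bump functions invariant under conjugation by `K`, and the smoothing family. -/

section Gauge

open scoped CompactlySupported

variable {G : Type*} [Group G] [TopologicalSpace G]

/-- A continuous function on `G`, invariant under conjugation by `K`, whose sublevel sets form a
basis of compact neighbourhoods of `1`. -/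
structure IsConjGauge (K : Subgroup G) (d : G → ℝ) : Prop where
  continuous : Continuous d
  map_one : d 1 = 0
  pos : ∀ g, g ≠ 1 → 0 < d g
  compact : IsCompact {g | d g ≤ 1}
  conj : ∀ k ∈ K, ∀ g, d (k * g * k⁻¹) = d g

variable {K : Subgroup G} {d : G → ℝ}

theorem IsConjGauge.exists_subset (hd : IsConjGauge K d) {U : Set G} (hU : IsOpen U)
    (h1 : (1 : G) ∈ U) : ∃ ε, 0 < ε ∧ ε ≤ 1 ∧ ∀ g, d g < ε → g ∈ U := by
  have hc : IsCompact ({g | d g ≤ 1} \ U) := hd.compact.diff hU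
  rcases ({g | d g ≤ 1} \ U).eq_empty_or_nonempty with h | h
  · refine ⟨1, one_pos, le_rfl, fun g hg => ?_⟩
    exact Set.sdiff_eq_empty.1 h hg.le
  · obtain ⟨g₀, hg₀, hmin⟩ := hc.exists_isMinOn h hd.continuous.continuousOn
    have hpos : 0 < d g₀ := hd.pos g₀ fun h => hg₀.2 (h ▸ h1)
    refine ⟨d g₀, hpos, hg₀.1, fun g hg => ?_⟩
    by_contra hgU
    exact absurd (hmin ⟨hg.le.trans hg₀.1, hgU⟩ : d g₀ ≤ d g) (not_le.2 hg)

/-- The bump function `max(0, ε - d)`. -/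
def IsConjGauge.bump (hd : IsConjGauge K d) (ε : {ε : ℝ // ε ≤ 1}) : C_c(G, ℂ) where
  toFun g := ((max 0 (ε - d g) : ℝ) : ℂ)
  continuous_toFun := by
    have := hd.continuous
    fun_prop
  hasCompactSupport' := by
    refine HasCompactSupport.intro' hd.compact (isClosed_le hd.continuous continuous_const) ?_
    intro g hg
    have h1 : ¬ d g ≤ 1 := hg
    have h2 : (ε : ℝ) - d g ≤ 0 := by linarith [ε.2]
    simp [max_eq_left h2]

theorem IsConjGauge.bump_apply (hd : IsConjGauge K d) (ε : {ε : ℝ // ε ≤ 1}) (g : G) :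
    hd.bump ε g = ((max 0 (ε - d g) : ℝ) : ℂ) := rfl

variable [IsTopologicalGroup G] [LocallyCompactSpace G] [SecondCountableTopology G]
  [T2Space G] [MeasurableSpace G] [BorelSpace G] (ν : Measure G)
  [ν.IsHaarMeasure]

/-- Near `1` the values of `u` stay in the open half-plane around `u 1`, so a bump supported there
cannot integrate `u` to zero. -/
theorem IsConjGauge.exists_integral_bump_ne_zero (hd : IsConjGauge K d) {u : G → ℂ}
    (hu : Continuous u) (hu1 : u 1 ≠ 0) : ∃ ε, ∫ h, hd.bump ε h * u h ∂ν ≠ 0 := by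
  let w : G → ℝ := fun h => (starRingEnd ℂ (u 1) * u h).re
  have hw : Continuous w := Complex.continuous_re.comp (continuous_const.mul hu)
  have hw1 : 0 < w 1 := by
    simp only [w, ← Complex.normSq_eq_conj_mul_self, Complex.ofReal_re]
    exact Complex.normSq_pos.2 hu1
  obtain ⟨ε, hε0, hε1, hε⟩ := hd.exists_subset (hw.isOpen_preimage _ isOpen_Ioi) hw1
  refine ⟨⟨ε, hε1⟩, fun h0 => ?_⟩
  have hint : Integrable (fun h => hd.bump ⟨ε, hε1⟩ h * u h) ν :=
    integrable_smul ν (hd.bump ⟨ε, hε1⟩) hu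
  have hint' := hint.const_mul (starRingEnd ℂ (u 1))
  have h1 : ∫ h, max 0 (ε - d h) * w h ∂ν = 0 := by
    have h2 := congrArg (fun z => (starRingEnd ℂ (u 1) * z).re) h0
    simp only [mul_zero, Complex.zero_re] at h2
    rw [← integral_const_mul, ← RCLike.re_eq_complex_re, ← integral_re hint'] at h2
    refine Eq.trans (integral_congr_ae (.of_forall fun h => ?_)) h2
    simp only [w, RCLike.re_eq_complex_re, hd.bump_apply]
    rw [mul_left_comm, Complex.re_ofReal_mul]
  have hc : Continuous fun h => max 0 (ε - d h) * w h := by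
    have := hd.continuous
    fun_prop
  refine absurd h1 (ne_of_gt (hc.integral_pos_of_hasCompactSupport_nonneg_nonzero ?_ ?_ (x := 1) ?_))
  · refine HasCompactSupport.intro' hd.compact (isClosed_le hd.continuous continuous_const) ?_
    intro g hg
    have h1 : ¬ d g ≤ 1 := hg
    have h2 : (ε : ℝ) - d g ≤ 0 := by linarith
    simp [max_eq_left h2]
  · intro g
    rcases lt_or_ge (d g) ε with h | h
    · exact mul_nonneg (le_max_left _ _) (hε g h).le
    · simp [max_eq_left (sub_nonpos.2 h)]
  · rw [hd.map_one, sub_zero, max_eq_right hε0.le]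
    exact (mul_pos hε0 hw1).ne'

/-- The image is a Haar measure, hence a multiple of `ν`. The factor is `1` because `{g | d g ≤ 1}`
is stable under conjugation by `k` and has positive finite measure. -/
theorem IsConjGauge.map_conj (hd : IsConjGauge K d) {k : G} (hk : k ∈ K) :
    ν.map (fun h => k * h * k⁻¹) = ν := by
  have hcont : Continuous fun h : G => k * h * k⁻¹ := by fun_prop
  have hHaar : (ν.map (MulAut.conj k)).IsHaarMeasure := by
    refine MulEquiv.isHaarMeasure_map ν (MulAut.conj k) hcont ?_
    have : (⇑(MulAut.conj k).symm : G → G) = fun h => k⁻¹ * h * k := by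
      ext h; simp
    rw [this]
    fun_prop
  have hmap : ν.map (fun h => k * h * k⁻¹) = ν.map (MulAut.conj k) := rfl
  have hsmul := Measure.isMulLeftInvariant_eq_smul (ν.map (MulAut.conj k)) ν
  set c := Measure.haarScalarFactor (ν.map (MulAut.conj k)) ν
  have hmeas : MeasurableSet {g | d g ≤ 1} :=
    (isClosed_le hd.continuous continuous_const).measurableSet
  have h1 : ν.map (MulAut.conj k) {g | d g ≤ 1} = ν {g | d g ≤ 1} := by
    rw [← hmap, Measure.map_apply hcont.measurable hmeas]
    congr 1
    ext g
    simp [hd.conj k hk]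
  have hne : ν {g | d g ≤ 1} ≠ 0 := by
    have hopen : IsOpen {g | d g < 1} := isOpen_lt hd.continuous continuous_const
    have := hopen.measure_pos ν ⟨1, by simp [hd.map_one]⟩
    exact (this.trans_le (measure_mono fun g hg => (le_of_lt hg : d g ≤ 1))).ne'
  have hc : (c : ℝ≥0∞) = 1 := by
    rw [hsmul] at h1
    exact (ENNReal.mul_eq_right hne hd.compact.measure_lt_top.ne).1 h1
  rw [hmap, hsmul]
  have : c = 1 := by exact_mod_cast hc
  rw [this, one_smul]

theorem IsConjGauge.average_commute (hd : IsConjGauge K d) (Γ : Subgroup G) [IsCocompactLattice Γ]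
    (ε : {ε : ℝ // ε ≤ 1}) {k : G} (hk : k ∈ K) (v : L2 Γ) :
    average Γ ν (hd.bump ε) (rightRegular Γ k v) =
      rightRegular Γ k (average Γ ν (hd.bump ε) v) := by
  have hcont : Continuous fun h : G => k * h * k⁻¹ := by fun_prop
  have hcomm := (rightRegular Γ k).toContinuousLinearEquiv.toContinuousLinearMap.integral_comp_comm
    (integrable_smul ν (hd.bump ε) (continuous_rightRegular Γ v))
  rw [average_apply, average_apply]
  refine Eq.trans ?_ hcomm
  conv_lhs => rw [← hd.map_conj ν hk]
  rw [integral_map hcont.aemeasurable]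
  · refine integral_congr_ae (.of_forall fun h => ?_)
    have h1 : rightRegular Γ (k * h * k⁻¹) (rightRegular Γ k v) =
        rightRegular Γ k (rightRegular Γ h v) := by
      change (rightRegular Γ (k * h * k⁻¹) * rightRegular Γ k) v =
        (rightRegular Γ k * rightRegular Γ h) v
      rw [← map_mul, ← map_mul, inv_mul_cancel_right]
    have h2 : hd.bump ε (k * h * k⁻¹) = hd.bump ε h := by
      rw [hd.bump_apply, hd.bump_apply, hd.conj k hk]
    simp only [h1, h2]
    exact ((rightRegular Γ k).map_smul _ _).symm
  · rw [hd.map_conj ν hk]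
    exact (integrable_smul ν (hd.bump ε)
      (continuous_rightRegular Γ (rightRegular Γ k v))).aestronglyMeasurable

open ContinuousLinearMap in
/-- The positive operators `R R†`, where `R` is the average against a bump function. -/
def IsConjGauge.smoothing (hd : IsConjGauge K d) (Γ : Subgroup G) [IsCocompactLattice Γ] :
    Set (L2 Γ →L[ℂ] L2 Γ) :=
  {T | ∃ ε, T = average Γ ν (hd.bump ε) ∘L adjoint (average Γ ν (hd.bump ε))}

open ContinuousLinearMap in
-- `R R†` is symmetric whether or not `d` is invariant under inversion, and its values lie in the
-- range of `R`. If `R R† v = 0` then `R† v = 0`, so `⟨v, R v⟩ = 0`; a small bump excludes this for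
-- `v ≠ 0`.
theorem IsConjGauge.isSmoothingFamily (hd : IsConjGauge K d) (Γ : Subgroup G)
    [IsCocompactLattice Γ] : IsSmoothingFamily (rightRegular Γ) K (hd.smoothing ν Γ) where
  compact := by
    rintro _ ⟨ε, rfl⟩
    exact (isCompactOperator_average Γ ν _).comp_clm _
  symmetric := by
    rintro _ ⟨ε, rfl⟩ v w
    simp only [coe_coe, coe_comp, Function.comp_apply]
    rw [← adjoint_inner_right, adjoint_inner_left]
  invariant := by
    rintro _ ⟨ε, rfl⟩ V hV v hv
    refine average_mem Γ ν _ hV ?_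
    have : CompleteSpace V := hV.isClosed.completeSpace_coe
    rw [← V.orthogonal_orthogonal, Submodule.mem_orthogonal]
    intro u hu
    refine (adjoint_inner_right _ _ _).trans ?_
    exact Submodule.inner_left_of_mem_orthogonal hv (average_mem Γ ν _ hV.orthogonal hu)
  commute := by
    rintro _ ⟨ε, rfl⟩ k hk v
    simp only [coe_comp, Function.comp_apply]
    rw [← hd.average_commute ν Γ ε hk]
    congr 1
    refine ext_inner_right ℂ fun w => ?_
    rw [adjoint_inner_left, inner_unitary_left, inner_unitary_left, adjoint_inner_left,
      hd.average_commute ν Γ ε (K.inv_mem hk)]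
  faithful := by
    intro v hv
    let u : G → ℂ := fun h => inner ℂ v (rightRegular Γ h v)
    have hu : Continuous u := continuous_const.inner (continuous_rightRegular Γ v)
    have hu1 : u 1 ≠ 0 := by simpa [u] using hv
    obtain ⟨ε, hε⟩ := hd.exists_integral_bump_ne_zero ν hu hu1
    refine ⟨_, ⟨ε, rfl⟩, fun h0 => hε ?_⟩
    have h1 : adjoint (average Γ ν (hd.bump ε)) v = 0 := by
      rw [← inner_self_eq_zero (𝕜 := ℂ), adjoint_inner_left]
      simp only [coe_comp, Function.comp_apply] at h0
      rw [h0, inner_zero_right]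
    have h2 : inner ℂ v (average Γ ν (hd.bump ε) v) = 0 := by
      rw [← adjoint_inner_left, h1, inner_zero_left]
    rw [average_apply, ← integral_inner
      (integrable_smul ν (hd.bump ε) (continuous_rightRegular Γ v))] at h2
    simpa [inner_smul_right] using h2

end Gauge

/-! ### Invariant `L²`-dense sets of continuous functions separate points. -/

section Separation

variable {G : Type*} [Group G] [TopologicalSpace G] [IsTopologicalGroup G]
  [LocallyCompactSpace G] [SecondCountableTopology G] [T2Space G] {K : Subgroup G} {d : G → ℝ}

/-- A translation invariant set of continuous functions which is dense in `L²(Γ \ G)` separates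
points. -/
theorem IsConjGauge.separatesPoints (hd : IsConjGauge K d) (Γ : Subgroup G) [IsCocompactLattice Γ]
    {B : Set C(RightQuotient Γ, ℂ)} (hB : ∀ f ∈ B, ∀ h, translateC Γ f h ∈ B)
    (hdense : Dense (toL2 Γ '' B)) {x y : RightQuotient Γ} (hxy : ∀ f ∈ B, f x = f y) :
    x = y := by
  let : MeasurableSpace G := borel G
  have : BorelSpace G := ⟨rfl⟩
  let ν : Measure G := Measure.haar
  by_contra hne
  obtain ⟨f, hf⟩ : ∃ f : C(RightQuotient Γ, ℂ), f x - f y ≠ 0 := by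
    obtain ⟨f, hf0, hf1, -⟩ := exists_continuous_zero_one_of_isClosed
      (isClosed_singleton (x := x)) (isClosed_singleton (x := y)) (by simpa using hne)
    refine ⟨⟨fun z => (f z : ℂ), by fun_prop⟩, ?_⟩
    have h0 : f x = 0 := hf0 rfl
    have h1 : f y = 1 := hf1 rfl
    simp [h0, h1]
  let u : G → ℂ := fun h => f (RightQuotient.rightMul Γ h x) - f (RightQuotient.rightMul Γ h y)
  have hux : ∀ z, Continuous fun h => f (RightQuotient.rightMul Γ h z) := fun z =>
    f.continuous.comp ((continuous_rightMul_uncurry Γ).comp (Continuous.prodMk_left z))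
  -- Point values are not continuous in `L²`, but point values of averages are. A small bump keeps
  -- the averages of `f` at `x` and `y` distinct, while those of `b ∈ B` agree by invariance of `B`;
  -- approximating `f` by such `b` is contradictory.
  obtain ⟨ε, hε⟩ := hd.exists_integral_bump_ne_zero ν (u := u) ((hux x).sub (hux y))
    (by simpa [u, rightMul_one] using hf)
  set φ := hd.bump ε
  have hint : ∀ z, Integrable (fun h => φ h * f (RightQuotient.rightMul Γ h z)) ν := fun z =>
    integrable_smul ν φ (hux z)
  have key : averageC Γ ν φ f x - averageC Γ ν φ f y ≠ 0 := by
    rw [averageC_apply, averageC_apply, ← integral_sub (hint x) (hint y)]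
    simpa only [u, mul_sub] using hε
  obtain ⟨N, hN⟩ := exists_norm_averageC_le Γ ν φ
  have hBxy : ∀ b ∈ B, averageC Γ ν φ b x = averageC Γ ν φ b y := by
    intro b hb
    rw [averageC_apply, averageC_apply]
    refine integral_congr_ae (.of_forall fun h => ?_)
    have := hxy _ (hB b hb h)
    simp only [translateC_apply] at this
    simp only [this]
  have hle : ∀ b ∈ B, ‖averageC Γ ν φ f x - averageC Γ ν φ f y‖ ≤
      2 * N * ‖toL2 Γ f - toL2 Γ b‖ := by
    intro b hb
    have h1 := hN (f - b) x
    have h2 := hN (f - b) y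
    rw [averageC_sub, ContinuousMap.sub_apply, map_sub] at h1 h2
    have h3 : averageC Γ ν φ f x - averageC Γ ν φ f y =
        (averageC Γ ν φ f x - averageC Γ ν φ b x) -
          (averageC Γ ν φ f y - averageC Γ ν φ b y) := by rw [hBxy b hb]; ring
    rw [h3]
    refine (norm_sub_le _ _).trans ?_
    linarith
  have hcl : toL2 Γ f ∈ closure (toL2 Γ '' B) := hdense _
  have h0 : ‖averageC Γ ν φ f x - averageC Γ ν φ f y‖ ≤ 2 * N * ‖toL2 Γ f - toL2 Γ f‖ := by
    have hclosed : IsClosed {v : L2 Γ | ‖averageC Γ ν φ f x - averageC Γ ν φ f y‖ ≤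
        2 * N * ‖toL2 Γ f - v‖} := isClosed_le continuous_const (by fun_prop)
    refine closure_minimal ?_ hclosed hcl
    rintro _ ⟨b, hb, rfl⟩
    exact hle b hb
  rw [sub_self, norm_zero, mul_zero, norm_le_zero_iff] at h0
  exact key h0

end Separation

/-! ### Continuous functions as multiplication operators on `L²`. -/

section Multiplication

variable {G : Type*} [Group G] [TopologicalSpace G] [IsTopologicalGroup G]
  [LocallyCompactSpace G] [SecondCountableTopology G] [T2Space G]
  (Γ : Subgroup G) [IsCocompactLattice Γ]

/-- Multiplication by a continuous function, as an operator on `L²(Γ \ G)`. -/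
def mulL : C(RightQuotient Γ, ℂ) →L[ℂ] (L2 Γ →L[ℂ] L2 Γ) :=
  ((ContinuousLinearMap.mul ℂ ℂ).holderL (haarProb Γ) ∞ 2 2).comp
    (ContinuousMap.toLp ∞ (haarProb Γ) ℂ)

theorem mulL_coeFn (a : C(RightQuotient Γ, ℂ)) (f : L2 Γ) :
    mulL Γ a f =ᵐ[haarProb Γ] fun x => a x * f x := by
  have h1 : mulL Γ a f = (ContinuousLinearMap.mul ℂ ℂ).holder 2
      (ContinuousMap.toLp ∞ (haarProb Γ) ℂ a) f := rfl
  rw [h1]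
  filter_upwards [(ContinuousLinearMap.mul ℂ ℂ).coeFn_holder (r := 2)
    (ContinuousMap.toLp ∞ (haarProb Γ) ℂ a) f,
    ContinuousMap.coeFn_toLp (p := ∞) (𝕜 := ℂ) (haarProb Γ) a] with x hx hx'
  rw [hx, hx', ContinuousLinearMap.mul_apply']

theorem mulL_toL2 (a b : C(RightQuotient Γ, ℂ)) : mulL Γ a (toL2 Γ b) = toL2 Γ (a * b) := by
  refine Lp.ext ?_
  filter_upwards [mulL_coeFn Γ a (toL2 Γ b),
    ContinuousMap.coeFn_toLp (p := 2) (𝕜 := ℂ) (haarProb Γ) b,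
    ContinuousMap.coeFn_toLp (p := 2) (𝕜 := ℂ) (haarProb Γ) (a * b)] with x h1 h2 h3
  rw [h1, h2, h3, ContinuousMap.mul_apply]

theorem ext_toL2 {E : Type*} [TopologicalSpace E] [T2Space E] {S T : L2 Γ → E}
    (hS : Continuous S) (hT : Continuous T) (h : ∀ b, S (toL2 Γ b) = T (toL2 Γ b)) : S = T :=
  (denseRange_toL2 Γ).equalizer hS hT (funext h)

open ContinuousLinearMap in
/-- The representation of `C(Γ \ G)` on `L²(Γ \ G)` by multiplication. -/
def mulHom : C(RightQuotient Γ, ℂ) →⋆ₐ[ℂ] (L2 Γ →L[ℂ] L2 Γ) where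
  toFun := mulL Γ
  map_one' := by
    refine DFunLike.coe_injective (ext_toL2 Γ (map_continuous _) (map_continuous _) fun b => ?_)
    rw [mulL_toL2, one_mul]
    rfl
  map_mul' a b := by
    refine DFunLike.coe_injective (ext_toL2 Γ (map_continuous _) (map_continuous _) fun c => ?_)
    change _ = mulL Γ a (mulL Γ b (toL2 Γ c))
    rw [mulL_toL2, mulL_toL2, mulL_toL2, mul_assoc]
  map_zero' := map_zero _
  map_add' := map_add _
  commutes' c := by
    refine DFunLike.coe_injective (ext_toL2 Γ (map_continuous _) (map_continuous _) fun b => ?_)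
    rw [mulL_toL2, ContinuousLinearMap.algebraMap_apply, ← Algebra.smul_def, map_smul]
  map_star' a := by
    rw [star_eq_adjoint, eq_adjoint_iff]
    intro f g
    rw [L2.inner_def, L2.inner_def]
    refine integral_congr_ae ?_
    filter_upwards [mulL_coeFn Γ (star a) f, mulL_coeFn Γ a g] with x h1 h2
    rw [h1, h2]
    simp only [RCLike.inner_apply, ContinuousMap.star_apply, map_mul, RCLike.star_def,
      Complex.conj_conj]
    ring

theorem mulHom_coeFn (a : C(RightQuotient Γ, ℂ)) (f : L2 Γ) :
    mulHom Γ a f =ᵐ[haarProb Γ] fun x => a x * f x := mulL_coeFn Γ a f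

theorem mulHom_toL2 (a b : C(RightQuotient Γ, ℂ)) : mulHom Γ a (toL2 Γ b) = toL2 Γ (a * b) :=
  mulL_toL2 Γ a b

theorem mulHom_one (a : C(RightQuotient Γ, ℂ)) : mulHom Γ a (toL2 Γ 1) = toL2 Γ a := by
  rw [mulHom_toL2, mul_one]

theorem mulHom_injective : Function.Injective (mulHom Γ) := fun a b h =>
  toL2_injective Γ (by rw [← mulHom_one, h, mulHom_one])

/-- An injective star homomorphism of C*-algebras is isometric. -/
theorem isClosed_range_mulHom : IsClosed (Set.range (mulHom Γ)) :=
  (NonUnitalStarAlgHom.isometry (mulHom Γ) (mulHom_injective Γ)).isClosedEmbedding.isClosed_range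

theorem translateC_mul (a b : C(RightQuotient Γ, ℂ)) (h : G) :
    translateC Γ (a * b) h = translateC Γ a h * translateC Γ b h := rfl

theorem translateC_inv (b : C(RightQuotient Γ, ℂ)) (h : G) :
    translateC Γ (translateC Γ b h⁻¹) h = b := by
  ext x
  simp [rightMul_rightMul, rightMul_one]

theorem mulHom_translateC (a : C(RightQuotient Γ, ℂ)) (h : G) (f : L2 Γ) :
    mulHom Γ (translateC Γ a h) f = rightRegular Γ h (mulHom Γ a (rightRegular Γ h⁻¹ f)) := by
  refine congrFun (ext_toL2 Γ (T := fun f => rightRegular Γ h (mulHom Γ a (rightRegular Γ h⁻¹ f)))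
    (map_continuous (mulHom Γ (translateC Γ a h))) ?_ fun b => ?_) f
  · exact (rightRegular Γ h).continuous.comp
      ((mulHom Γ a).continuous.comp (rightRegular Γ h⁻¹).continuous)
  · simp only [← toL2_translateC, mulHom_toL2, translateC_mul, translateC_inv]

end Multiplication

/-! ### `Φ` conjugates multiplication operators on a dense set. -/

section Isomorphism

variable {G : Type*} [Group G] [TopologicalSpace G] [IsTopologicalGroup G]
  [LocallyCompactSpace G] [SecondCountableTopology G] [T2Space G]
  {K : Subgroup G} {d : G → ℝ} {Γ Γ' : Subgroup G} [IsCocompactLattice Γ] [IsCocompactLattice Γ']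

section Intertwining

open ContinuousLinearMap

variable [MeasurableSpace G] [BorelSpace G] (ν : Measure G) [ν.IsHaarMeasure]
  {Φ : L2 Γ ≃ₗᵢ[ℂ] L2 Γ'}

open scoped CompactlySupported in
theorem map_average (hΦ : ∀ h f, Φ (rightRegular Γ h f) = rightRegular Γ' h (Φ f))
    (φ : C_c(G, ℂ)) (v : L2 Γ) : Φ (average Γ ν φ v) = average Γ' ν φ (Φ v) := by
  have h1 := Φ.toContinuousLinearEquiv.toContinuousLinearMap.integral_comp_comm
    (integrable_smul ν φ (continuous_rightRegular Γ v))
  rw [average_apply, average_apply]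
  refine h1.symm.trans (integral_congr_ae (.of_forall fun h => ?_))
  simp only [← hΦ]
  exact Φ.map_smul _ _

open scoped CompactlySupported in
theorem map_adjoint_average (hΦ : ∀ h f, Φ (rightRegular Γ h f) = rightRegular Γ' h (Φ f))
    (φ : C_c(G, ℂ)) (v : L2 Γ) :
    Φ (adjoint (average Γ ν φ) v) = adjoint (average Γ' ν φ) (Φ v) := by
  refine ext_inner_right ℂ fun w => ?_
  obtain ⟨w, rfl⟩ := Φ.surjective w
  rw [adjoint_inner_left, ← map_average ν hΦ, Φ.inner_map_map, Φ.inner_map_map, adjoint_inner_left]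

theorem IsConjGauge.exists_toL2_eq (hd : IsConjGauge K d) {T : L2 Γ →L[ℂ] L2 Γ}
    (hT : T ∈ hd.smoothing ν Γ) (v : L2 Γ) : ∃ a, toL2 Γ a = T v := by
  obtain ⟨ε, rfl⟩ := hT
  exact exists_toL2_eq_average Γ ν _ _

/-- `Φ` carries `R R†` on `L2 Γ` to the same operator on `L2 Γ'`, whose values are continuous. No
prior knowledge that `Φ` preserves continuity is needed. -/
theorem IsConjGauge.exists_toL2_eq_map (hd : IsConjGauge K d)
    (hΦ : ∀ h f, Φ (rightRegular Γ h f) = rightRegular Γ' h (Φ f)) {T : L2 Γ →L[ℂ] L2 Γ}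
    (hT : T ∈ hd.smoothing ν Γ) (v : L2 Γ) : ∃ a, toL2 Γ' a = Φ (T v) := by
  obtain ⟨ε, rfl⟩ := hT
  obtain ⟨a, ha⟩ := exists_toL2_eq_average Γ' ν (hd.bump ε)
    (adjoint (average Γ' ν (hd.bump ε)) (Φ v))
  refine ⟨a, ha.trans ?_⟩
  rw [← map_adjoint_average ν hΦ, ← map_average ν hΦ, comp_apply]

end Intertwining

/-- For a unitary equivalence of multiplicative representations, there is a dense subspace of
vectors which, together with their images, are represented by continuous functions whose
multiplication operators are intertwined. -/
theorem exists_dense_intertwined (hd : IsConjGauge K d) {Φ : L2 Γ ≃ₗᵢ[ℂ] L2 Γ'}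
    (hrep : ∀ h f, Φ (rightRegular Γ h f) = rightRegular Γ' h (Φ f))
    (hmul : ∀ α ∈ finVectors (rightRegular Γ) K, ∀ β ∈ finVectors (rightRegular Γ) K,
      ∀ γ : L2 Γ, γ =ᵐ[haarProb Γ] (fun x => α x * β x) →
        Φ γ =ᵐ[haarProb Γ'] fun x => Φ α x * Φ β x) :
    ∃ D : Set (L2 Γ), Dense D ∧ ∀ α ∈ D, ∃ a a', toL2 Γ a = α ∧ toL2 Γ' a' = Φ α ∧
      Φ.conjStarAlgEquiv (mulHom Γ a) = mulHom Γ' a' := by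
  let : MeasurableSpace G := borel G
  have : BorelSpace G := ⟨rfl⟩
  let ν : Measure G := Measure.haar
  have hfam := hd.isSmoothingFamily ν Γ
  let S := Submodule.span ℂ (eigenvectors (rightRegular Γ) (hd.smoothing ν Γ))
  have hS : Dense (S : Set (L2 Γ)) := hfam.dense_span
  refine ⟨S, hS, fun α hα => ?_⟩
  obtain ⟨a, ha⟩ : α ∈ (toL2 Γ).toLinearMap.range :=
    span_eigenvectors_le (fun T hT v => hd.exists_toL2_eq ν hT v) hα
  obtain ⟨a', ha'⟩ : α ∈ (toL2 Γ').toLinearMap.range.comap Φ.toLinearEquiv.toLinearMap :=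
    span_eigenvectors_le (fun T hT v => hd.exists_toL2_eq_map ν hrep hT v) hα
  have ha : toL2 Γ a = α := ha
  have ha' : toL2 Γ' a' = Φ α := ha'
  refine ⟨a, a', ha, ha', ?_⟩
  -- Both operators are bounded, so it is enough to compare them at `Φ β` with `β ∈ S`; there `α`
  -- and `β` both lie in `finVectors` and `hmul` applies.
  have hS' : Dense (Φ '' S) := Φ.surjective.denseRange.dense_image Φ.continuous hS
  refine DFunLike.coe_injective (Continuous.ext_on hS' (map_continuous _) (map_continuous _) ?_)
  rintro _ ⟨β, hβ, rfl⟩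
  rw [LinearIsometryEquiv.conjStarAlgEquiv_apply_apply, Φ.symm_apply_apply]
  have h1 : mulHom Γ a β =ᵐ[haarProb Γ] fun x => α x * β x := by
    filter_upwards [mulHom_coeFn Γ a β,
      ha ▸ ContinuousMap.coeFn_toLp (p := 2) (𝕜 := ℂ) (haarProb Γ) a] with x hx hx'
    rw [hx, hx']
  refine Lp.ext ((hmul α (hfam.span_le_finVectors hα) β (hfam.span_le_finVectors hβ) _ h1).trans ?_)
  filter_upwards [mulHom_coeFn Γ' a' (Φ β),
    ha' ▸ ContinuousMap.coeFn_toLp (p := 2) (𝕜 := ℂ) (haarProb Γ') a'] with x hx hx'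
  rw [hx, hx']

end Isomorphism

/-! ### From `Φ` to a map of spaces, and from there to a left translation. -/

section PointMap

variable {G : Type*} [Group G] [TopologicalSpace G] [IsTopologicalGroup G]
  [LocallyCompactSpace G] [SecondCountableTopology G] [T2Space G]
  {K : Subgroup G} {d : G → ℝ} {Γ Γ' : Subgroup G} [IsCocompactLattice Γ] [IsCocompactLattice Γ']

open WeakDual.CharacterSpace in
/-- Characters of `C(X)` are point evaluations. -/
theorem exists_eval_eq {X : Type*} [TopologicalSpace X] [CompactSpace X] [T2Space X]
    (χ : C(X, ℂ) →ₐ[ℂ] ℂ) : ∃ x, ∀ a, χ a = a x := by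
  obtain ⟨x, hx⟩ := (continuousMapEval_bijective (X := X) (𝕜 := ℂ)).2 (equivAlgHom.symm χ)
  refine ⟨x, fun a => ?_⟩
  have := DFunLike.congr_fun hx a
  rw [continuousMapEval_apply_apply] at this
  exact this.symm

theorem eq_of_forall_apply_eq {X : Type*} [TopologicalSpace X] [CompactSpace X] [T2Space X]
    {x y : X} (h : ∀ a : C(X, ℂ), a x = a y) : x = y :=
  (WeakDual.CharacterSpace.continuousMapEval_bijective (X := X) (𝕜 := ℂ)).1
    (DFunLike.ext _ _ h)

/-- With `u = Φ 1 - 1`, intertwining gives `a' u = Φ α - a' = 0`. Integrating, `star u` is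
orthogonal to the dense set of all `Φ α`. -/
theorem map_toL2_one {Φ : L2 Γ ≃ₗᵢ[ℂ] L2 Γ'} {D : Set (L2 Γ)} (hD : Dense D)
    (h : ∀ α ∈ D, ∃ a a', toL2 Γ a = α ∧ toL2 Γ' a' = Φ α ∧
      Φ.conjStarAlgEquiv (mulHom Γ a) = mulHom Γ' a') :
    Φ (toL2 Γ 1) = toL2 Γ' 1 := by
  set u := Φ (toL2 Γ 1) - toL2 Γ' 1 with hu
  have hD' : Dense (Φ '' D) := Φ.surjective.denseRange.dense_image Φ.continuous hD
  have key : ∀ v ∈ Φ '' D, inner ℂ (star u) v = 0 := by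
    rintro _ ⟨α, hα, rfl⟩
    obtain ⟨a, a', ha, ha', hc⟩ := h α hα
    have h1 : mulHom Γ' a' u = 0 := by
      rw [hu, map_sub, mulHom_one, ha', ← hc, LinearIsometryEquiv.conjStarAlgEquiv_apply_apply,
        Φ.symm_apply_apply, mulHom_one, ha, sub_self]
    rw [L2.inner_def]
    refine integral_eq_zero_of_ae ?_
    have h2 := mulHom_coeFn Γ' a' u
    rw [h1] at h2
    filter_upwards [h2, Lp.coeFn_zero ℂ 2 (haarProb Γ'), Lp.coeFn_star u,
      ha' ▸ ContinuousMap.coeFn_toLp (p := 2) (𝕜 := ℂ) (haarProb Γ') a'] with x h3 h4 h5 h6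
    rw [h4] at h3
    rw [h5, h6]
    simpa using h3.symm
  have h0 : star u = 0 := by
    refine hD'.eq_zero_of_inner_left ℂ fun v hv => ?_
    exact key v hv
  have : u = 0 := by
    rw [Lp.eq_zero_iff_ae_eq_zero]
    have h1 := Lp.coeFn_star u
    rw [h0] at h1
    filter_upwards [h1, Lp.coeFn_zero ℂ 2 (haarProb Γ')] with x h2 h3
    rw [h3] at h2
    simpa using h2.symm
  exact sub_eq_zero.1 this

/-- The isomorphism of algebras of continuous functions induced by an isomorphism of
multiplicative representations. -/
theorem exists_algHom (hd : IsConjGauge K d) {Φ : L2 Γ ≃ₗᵢ[ℂ] L2 Γ'}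
    (hrep : ∀ h f, Φ (rightRegular Γ h f) = rightRegular Γ' h (Φ f)) {D : Set (L2 Γ)}
    (hD : Dense D) (h : ∀ α ∈ D, ∃ a a', toL2 Γ a = α ∧ toL2 Γ' a' = Φ α ∧
      Φ.conjStarAlgEquiv (mulHom Γ a) = mulHom Γ' a') :
    ∃ Ψ : C(RightQuotient Γ, ℂ) →ₐ[ℂ] C(RightQuotient Γ', ℂ),
      ∀ a, Φ (toL2 Γ a) = toL2 Γ' (Ψ a) := by
  let c : C(RightQuotient Γ, ℂ) →⋆ₐ[ℂ] (L2 Γ' →L[ℂ] L2 Γ') :=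
    (Φ.conjStarAlgEquiv : (L2 Γ →L[ℂ] L2 Γ) →⋆ₐ[ℂ] (L2 Γ' →L[ℂ] L2 Γ')).comp (mulHom Γ)
  have hc_apply : ∀ a v, c a v = Φ (mulHom Γ a (Φ.symm v)) := fun a v => rfl
  have hc : Continuous c := by
    refine (NonUnitalStarAlgHom.isometry c fun a b hab => mulHom_injective Γ ?_).continuous
    exact Φ.conjStarAlgEquiv.injective hab
  -- The set `D` need not be closed under products or conjugation. Passing to `P` supplies an
  -- algebra to which Stone-Weierstrass applies.
  let P : StarSubalgebra ℂ C(RightQuotient Γ, ℂ) := (mulHom Γ').range.comap c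
  have hP : ∀ a, a ∈ P ↔ ∃ a', mulHom Γ' a' = c a := fun a => Iff.rfl
  have hPclosed : IsClosed (P : Set C(RightQuotient Γ, ℂ)) :=
    (isClosed_range_mulHom Γ').preimage hc
  have hPtrans : ∀ a ∈ (P : Set C(RightQuotient Γ, ℂ)), ∀ g,
      translateC Γ a g ∈ (P : Set C(RightQuotient Γ, ℂ)) := by
    intro a ha g
    obtain ⟨a', ha'⟩ := (hP a).1 ha
    refine (hP _).2 ⟨translateC Γ' a' g, ?_⟩
    refine ContinuousLinearMap.ext fun v => ?_
    obtain ⟨v, rfl⟩ := Φ.surjective v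
    rw [mulHom_translateC, ha', hc_apply, hc_apply, mulHom_translateC, ← hrep, ← hrep,
      Φ.symm_apply_apply, Φ.symm_apply_apply]
  have hPdense : Dense (toL2 Γ '' P) := by
    refine hD.mono fun α hα => ?_
    obtain ⟨a, a', ha, -, haa'⟩ := h α hα
    exact ⟨a, (hP a).2 ⟨a', haa'.symm⟩, ha⟩
  have hPsep : P.SeparatesPoints := by
    intro x y hxy
    by_contra hcon
    refine hxy (hd.separatesPoints Γ hPtrans hPdense fun f hf => ?_)
    by_contra hne
    exact hcon ⟨f, ⟨f, hf, rfl⟩, hne⟩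
  have hPtop : ∀ a, c a ∈ (mulHom Γ').range := by
    intro a
    have h1 := ContinuousMap.starSubalgebra_topologicalClosure_eq_top_of_separatesPoints P hPsep
    have h2 : a ∈ P.topologicalClosure := h1 ▸ StarSubalgebra.mem_top
    have h3 : a ∈ closure (P : Set C(RightQuotient Γ, ℂ)) := h2
    rw [hPclosed.closure_eq] at h3
    exact h3
  let e := AlgEquiv.ofInjective (mulHom Γ').toAlgHom (mulHom_injective Γ')
  let c' := c.toAlgHom.codRestrict (mulHom Γ').toAlgHom.range hPtop
  refine ⟨e.symm.toAlgHom.comp c', fun a => ?_⟩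
  have h1 : mulHom Γ' (e.symm (c' a)) = c a := congrArg Subtype.val (e.apply_symm_apply (c' a))
  change _ = toL2 Γ' (e.symm (c' a))
  -- A multiplication operator is read off from its value at `1`, and `Φ` fixes `1`.
  rw [← mulHom_one Γ', h1, hc_apply, ← map_toL2_one hD h, Φ.symm_apply_apply, mulHom_one]

/-- An isomorphism of multiplicative representations is given by composition with an injective
equivariant map. -/
theorem exists_pointMap (hd : IsConjGauge K d) {Φ : L2 Γ ≃ₗᵢ[ℂ] L2 Γ'}
    (hrep : ∀ h f, Φ (rightRegular Γ h f) = rightRegular Γ' h (Φ f)) {D : Set (L2 Γ)}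
    (hD : Dense D) (h : ∀ α ∈ D, ∃ a a', toL2 Γ a = α ∧ toL2 Γ' a' = Φ α ∧
      Φ.conjStarAlgEquiv (mulHom Γ a) = mulHom Γ' a') :
    ∃ θ : RightQuotient Γ' → RightQuotient Γ, Function.Injective θ ∧
      (∀ g x, θ (RightQuotient.rightMul Γ' g x) = RightQuotient.rightMul Γ g (θ x)) ∧
      ∀ a, ∃ a' : C(RightQuotient Γ', ℂ), Φ (toL2 Γ a) = toL2 Γ' a' ∧ ∀ x, a' x = a (θ x) := by
  obtain ⟨Ψ, hΨ⟩ := exists_algHom hd hrep hD h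
  have hθ : ∀ x, ∃ y, ∀ a, Ψ a x = a y := fun x =>
    exists_eval_eq ((ContinuousMap.evalAlgHom ℂ ℂ x).comp Ψ)
  choose θ hθ using hθ
  have htrans : ∀ a g, Ψ (translateC Γ a g) = translateC Γ' (Ψ a) g := by
    intro a g
    refine toL2_injective Γ' ?_
    rw [← hΨ, toL2_translateC, hrep, hΨ, toL2_translateC]
  refine ⟨θ, fun x y hxy => ?_, fun g x => ?_, fun a => ⟨Ψ a, hΨ a, fun x => hθ x a⟩⟩
  -- The range of `Ψ` is translation-invariant and contains representatives of the dense set `Φ ''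
  -- D`, so it separates points of `Γ' \ G`.
  · refine hd.separatesPoints Γ' (B := Set.range Ψ) ?_ ?_ ?_
    · rintro _ ⟨a, rfl⟩ g
      exact ⟨_, htrans a g⟩
    · refine (Φ.surjective.denseRange.dense_image Φ.continuous hD).mono ?_
      rintro _ ⟨α, hα, rfl⟩
      obtain ⟨a, a', ha, ha', -⟩ := h α hα
      exact ⟨Ψ a, ⟨a, rfl⟩, by rw [← hΨ, ha]⟩
    · rintro _ ⟨a, rfl⟩
      rw [hθ, hθ, hxy]
  · refine eq_of_forall_apply_eq fun a => ?_
    have h1 := hθ x (translateC Γ a g)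
    rwa [htrans, translateC_apply, translateC_apply, hθ] at h1

/-- An injective equivariant map `Γ' \ G → Γ \ G` is a left translation. -/
theorem exists_eq_leftMulInv {G : Type*} [Group G] {Γ Γ' : Subgroup G}
    {θ : RightQuotient Γ' → RightQuotient Γ} (hinj : Function.Injective θ)
    (hθ : ∀ g x, θ (RightQuotient.rightMul Γ' g x) = RightQuotient.rightMul Γ g (θ x)) :
    ∃ g, ∃ hg : Γ' = Γ.map (MulAut.conj g).toMonoidHom, θ = RightQuotient.leftMulInv g hg := by
  obtain ⟨g, hg⟩ := RightQuotient.mk_surjective Γ (θ (RightQuotient.mk Γ' 1))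
  have hθ' : ∀ x, θ (RightQuotient.mk Γ' x) = RightQuotient.mk Γ (g * x) := by
    intro x
    have := hθ x (RightQuotient.mk Γ' 1)
    rwa [RightQuotient.rightMul_mk, one_mul, ← hg, RightQuotient.rightMul_mk] at this
  -- Well-definedness of `θ` gives one implication, injectivity the other. This `g` is the inverse
  -- of the one in the conclusion.
  have hmem : ∀ x, x ∈ Γ' ↔ g * x * g⁻¹ ∈ Γ := by
    intro x
    have h1 : x ∈ Γ' ↔ RightQuotient.mk Γ' 1 = RightQuotient.mk Γ' x := by
      rw [RightQuotient.mk_eq_mk, inv_one, mul_one]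
    rw [h1, ← hinj.eq_iff, hθ', hθ', RightQuotient.mk_eq_mk, mul_one]
  have hΓ : Γ' = Γ.map (MulAut.conj g⁻¹).toMonoidHom := by
    ext x
    rw [hmem, Subgroup.mem_map]
    constructor
    · intro hx
      exact ⟨_, hx, by simp [mul_assoc]⟩
    · rintro ⟨y, hy, rfl⟩
      simpa [mul_assoc] using hy
  refine ⟨g⁻¹, hΓ, funext fun x => ?_⟩
  obtain ⟨x, rfl⟩ := RightQuotient.mk_surjective Γ' x
  rw [hθ']
  change _ = RightQuotient.mk Γ (g⁻¹⁻¹ * x)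
  rw [inv_inv]

/-- A map which induces a unitary operator on continuous functions preserves the measure and
induces this operator on all of `L²`. -/
theorem map_coeFn_of_continuous {Φ : L2 Γ ≃ₗᵢ[ℂ] L2 Γ'} {θ : RightQuotient Γ' → RightQuotient Γ}
    (hθ : Continuous θ) (h : ∀ a, ∃ a' : C(RightQuotient Γ', ℂ), Φ (toL2 Γ a) = toL2 Γ' a' ∧
      ∀ x, a' x = a (θ x)) (f : L2 Γ) :
    Φ f =ᵐ[haarProb Γ'] fun x => f (θ x) := by
  have h' : ∀ a : C(RightQuotient Γ, ℂ), Φ (toL2 Γ a) = toL2 Γ' (a.comp ⟨θ, hθ⟩) := by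
    intro a
    obtain ⟨a', ha', haθ⟩ := h a
    rw [ha']
    congr 1
    exact ContinuousMap.ext haθ
  have hint : ∀ (Δ : Subgroup G) [IsCocompactLattice Δ] (a : C(RightQuotient Δ, ℂ)),
      ∫ x, a x ∂(haarProb Δ) = inner ℂ (toL2 Δ 1) (toL2 Δ a) := by
    intro Δ _ a
    rw [ContinuousMap.inner_toLp]
    simp
  have hone : Φ (toL2 Γ 1) = toL2 Γ' 1 := h' 1
  -- Integration is the inner product with `1`; since `Φ` is unitary and fixes `1`, composition with
  -- `θ` preserves integrals of continuous functions.
  have hmp : MeasurePreserving θ (haarProb Γ') (haarProb Γ) := by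
    refine ⟨hθ.measurable, ?_⟩
    have : IsProbabilityMeasure ((haarProb Γ').map θ) :=
      Measure.isProbabilityMeasure_map hθ.aemeasurable
    refine ext_of_forall_integral_eq_of_IsFiniteMeasure fun f => ?_
    rw [integral_map hθ.aemeasurable f.continuous.aestronglyMeasurable]
    let a : C(RightQuotient Γ, ℂ) := ⟨fun x => (f x : ℂ), by fun_prop⟩
    have h1 := hint Γ a
    rw [← Φ.inner_map_map, hone, h', ← hint Γ'] at h1
    simp only [a, ContinuousMap.comp_apply, ContinuousMap.coe_mk, integral_complex_ofReal] at h1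
    exact_mod_cast h1.symm
  have hcomp : Φ f = Lp.compMeasurePreserving θ hmp f := by
    refine congrFun (ext_toL2 Γ (S := Φ) (T := Lp.compMeasurePreserving θ hmp) Φ.continuous
      (Lp.isometry_compMeasurePreserving hmp).continuous fun b => ?_) f
    rw [h']
    refine Lp.ext ?_
    filter_upwards [ContinuousMap.coeFn_toLp (p := 2) (𝕜 := ℂ) (haarProb Γ') (b.comp ⟨θ, hθ⟩),
      Lp.coeFn_compMeasurePreserving (toL2 Γ b) hmp, hmp.quasiMeasurePreserving.ae
        (ContinuousMap.coeFn_toLp (p := 2) (𝕜 := ℂ) (haarProb Γ) b)] with x h1 h2 h3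
    rw [h1, h2, Function.comp_apply, h3]
    rfl
  rw [hcomp]
  exact Lp.coeFn_compMeasurePreserving f hmp

/-- An isomorphism of multiplicative representations is a left translation. -/
theorem exists_leftTranslation (hd : IsConjGauge K d) {Φ : L2 Γ ≃ₗᵢ[ℂ] L2 Γ'}
    (hrep : ∀ h f, Φ (rightRegular Γ h f) = rightRegular Γ' h (Φ f))
    (hmul : ∀ α ∈ finVectors (rightRegular Γ) K, ∀ β ∈ finVectors (rightRegular Γ) K,
      ∀ γ : L2 Γ, γ =ᵐ[haarProb Γ] (fun x => α x * β x) →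
        Φ γ =ᵐ[haarProb Γ'] fun x => Φ α x * Φ β x) :
    ∃ g, ∃ hg : Γ' = Γ.map (MulAut.conj g).toMonoidHom,
      ∀ f : L2 Γ, Φ f =ᵐ[haarProb Γ'] fun x => f (RightQuotient.leftMulInv g hg x) := by
  obtain ⟨D, hD, h⟩ := exists_dense_intertwined hd hrep hmul
  obtain ⟨θ, hinj, hequiv, hΦ⟩ := exists_pointMap hd hrep hD h
  -- Continuity of `θ` comes only from its identification with a left translation.
  obtain ⟨g, hg, rfl⟩ := exists_eq_leftMulInv hinj hequiv
  exact ⟨g, hg, map_coeFn_of_continuous (continuous_leftMulInv hg) hΦ⟩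

theorem leftMulInv_mk {g : G} (hg : Γ' = Γ.map (MulAut.conj g).toMonoidHom) (x : G) :
    RightQuotient.leftMulInv g hg (RightQuotient.mk Γ' x) = RightQuotient.mk Γ (g⁻¹ * x) := rfl

/-- Tested on continuous functions, the two translations agree almost everywhere, hence everywhere.
The value at the base coset determines the class of `g`. -/
theorem leftTranslation_unique {Φ : L2 Γ ≃ₗᵢ[ℂ] L2 Γ'} {g₁ g₂ : G}
    (hg₁ : Γ' = Γ.map (MulAut.conj g₁).toMonoidHom) (hg₂ : Γ' = Γ.map (MulAut.conj g₂).toMonoidHom)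
    (h₁ : ∀ f : L2 Γ, Φ f =ᵐ[haarProb Γ'] fun x => f (RightQuotient.leftMulInv g₁ hg₁ x))
    (h₂ : ∀ f : L2 Γ, Φ f =ᵐ[haarProb Γ'] fun x => f (RightQuotient.leftMulInv g₂ hg₂ x)) :
    (g₁ : G ⧸ Γ) = g₂ := by
  have key : RightQuotient.leftMulInv g₁ hg₁ = RightQuotient.leftMulInv g₂ hg₂ := by
    refine funext fun x => eq_of_forall_apply_eq fun b => ?_
    have hb := ContinuousMap.coeFn_toLp (p := 2) (𝕜 := ℂ) (haarProb Γ) b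
    have hae : (fun x => b (RightQuotient.leftMulInv g₁ hg₁ x)) =ᵐ[haarProb Γ']
        fun x => b (RightQuotient.leftMulInv g₂ hg₂ x) := by
      filter_upwards [h₁ (toL2 Γ b), h₂ (toL2 Γ b), (quasiMeasurePreserving_leftMulInv hg₁).ae hb,
        (quasiMeasurePreserving_leftMulInv hg₂).ae hb] with x h3 h4 h5 h6
      rw [← h5, ← h6, ← h3, ← h4]
    exact congrFun (((b.continuous.comp (continuous_leftMulInv hg₁)).ae_eq_iff_eq _
      (b.continuous.comp (continuous_leftMulInv hg₂))).1 hae) x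
  have h3 := congrFun key (RightQuotient.mk Γ' 1)
  rw [leftMulInv_mk, leftMulInv_mk, mul_one, mul_one, RightQuotient.mk_eq_mk, inv_inv] at h3
  rw [eq_comm, QuotientGroup.eq]
  exact h3

/-- Left translation by `g` only depends on the coset `g Γ`. -/
theorem leftTranslation_of_coe_eq {Φ : L2 Γ ≃ₗᵢ[ℂ] L2 Γ'} {g₁ g₂ : G}
    (hg₁ : Γ' = Γ.map (MulAut.conj g₁).toMonoidHom) (h : (g₂ : G ⧸ Γ) = g₁)
    (h₁ : ∀ f : L2 Γ, Φ f =ᵐ[haarProb Γ'] fun x => f (RightQuotient.leftMulInv g₁ hg₁ x)) :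
    ∃ hg₂ : Γ' = Γ.map (MulAut.conj g₂).toMonoidHom,
      ∀ f : L2 Γ, Φ f =ᵐ[haarProb Γ'] fun x => f (RightQuotient.leftMulInv g₂ hg₂ x) := by
  rw [QuotientGroup.eq] at h
  have hg₂ : Γ' = Γ.map (MulAut.conj g₂).toMonoidHom := by
    rw [hg₁]
    ext x
    rw [mem_map_conj, mem_map_conj]
    rw [← Γ.mul_mem_cancel_left h, ← Γ.mul_mem_cancel_right (Γ.inv_mem h)]
    simp [mul_assoc]
  refine ⟨hg₂, fun f => (h₁ f).trans (.of_forall fun x => ?_)⟩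
  obtain ⟨x, rfl⟩ := RightQuotient.mk_surjective Γ' x
  have : RightQuotient.mk Γ (g₁⁻¹ * x) = RightQuotient.mk Γ (g₂⁻¹ * x) := by
    rw [RightQuotient.mk_eq_mk]
    simpa [mul_assoc] using h
  simp only [leftMulInv_mk, this]

end PointMap

/-! ### A conjugation-invariant gauge on `PSL(2, ℝ)`. -/

section ProjectiveSpecialLinear

open Matrix

instance : T2Space PSL(2, ℝ) := by
  have : IsClosed (Subgroup.center SL(2, ℝ) : Set SL(2, ℝ)) := by
    rw [Subgroup.coe_center, ← Set.centralizer_univ]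
    exact Set.isClosed_centralizer _
  have : T3Space (SL(2, ℝ) ⧸ Subgroup.center SL(2, ℝ)) := inferInstance
  infer_instance

/-- `‖A - 1‖² ‖A + 1‖²` for the Frobenius norm. -/
def gaugeSL (A : SL(2, ℝ)) : ℝ :=
  (trace ((A : Matrix (Fin 2) (Fin 2) ℝ) * (A : Matrix (Fin 2) (Fin 2) ℝ)ᵀ) + 2) ^ 2 -
    4 * trace (A : Matrix (Fin 2) (Fin 2) ℝ) ^ 2

/-- A difference of squares. The trace form shows invariance under conjugation by rotations and
under sign change; the product form shows positivity and compactness of sublevel sets. -/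
theorem gaugeSL_eq (A : SL(2, ℝ)) : gaugeSL A =
    ((A 0 0 - 1) ^ 2 + A 0 1 ^ 2 + A 1 0 ^ 2 + (A 1 1 - 1) ^ 2) *
      ((A 0 0 + 1) ^ 2 + A 0 1 ^ 2 + A 1 0 ^ 2 + (A 1 1 + 1) ^ 2) := by
  have h := A.det_coe
  rw [det_fin_two] at h
  simp only [gaugeSL, trace_fin_two, mul_apply, Fin.sum_univ_two, transpose_apply]
  ring

theorem continuous_gaugeSL : Continuous gaugeSL := by
  have h : Continuous fun A : SL(2, ℝ) => (A : Matrix (Fin 2) (Fin 2) ℝ) := continuous_subtype_val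
  unfold gaugeSL
  fun_prop

theorem mem_center_of_gaugeSL_nonpos {A : SL(2, ℝ)} (hA : gaugeSL A ≤ 0) :
    A ∈ Subgroup.center SL(2, ℝ) := by
  rw [gaugeSL_eq] at hA
  have h0 := le_antisymm hA (by positivity)
  rw [Matrix.SpecialLinearGroup.mem_center_iff]
  have aux : ∀ r : ℝ, (A 0 0 - r) ^ 2 + A 0 1 ^ 2 + A 1 0 ^ 2 + (A 1 1 - r) ^ 2 = 0 →
      scalar (Fin 2) r = (A : Matrix (Fin 2) (Fin 2) ℝ) := by
    intro r h
    have h1 := sq_nonneg (A 0 0 - r)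
    have h2 := sq_nonneg (A 0 1)
    have h3 := sq_nonneg (A 1 0)
    have h4 := sq_nonneg (A 1 1 - r)
    have e1 : A 0 0 = r := sub_eq_zero.1 (pow_eq_zero_iff two_ne_zero |>.1 (by linarith))
    have e2 : A 0 1 = 0 := pow_eq_zero_iff two_ne_zero |>.1 (by linarith)
    have e3 : A 1 0 = 0 := pow_eq_zero_iff two_ne_zero |>.1 (by linarith)
    have e4 : A 1 1 = r := sub_eq_zero.1 (pow_eq_zero_iff two_ne_zero |>.1 (by linarith))
    ext i j
    fin_cases i <;> fin_cases j <;> simp [e1, e2, e3, e4]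
  rcases mul_eq_zero.1 h0 with h | h
  · exact ⟨1, by simp, aux 1 h⟩
  · exact ⟨-1, by simp, aux (-1) (by simpa only [sub_neg_eq_add] using h)⟩

theorem isCompact_gaugeSL_le : IsCompact {A | gaugeSL A ≤ 1} := by
  have hbox : IsCompact (Set.pi Set.univ fun _ => Set.pi Set.univ fun _ => Set.Icc (-2) 2 :
      Set (Fin 2 → Fin 2 → ℝ)) :=
    isCompact_univ_pi fun _ => isCompact_univ_pi fun _ => isCompact_Icc
  refine ((Matrix.SpecialLinearGroup.isClosedEmbedding_val (n := Fin 2)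
    (R := ℝ)).isCompact_preimage hbox).of_isClosed_subset
    (isClosed_le continuous_gaugeSL continuous_const) fun (A : SL(2, ℝ)) hA => ?_
  have hA : gaugeSL A ≤ 1 := hA
  rw [gaugeSL_eq] at hA
  have aux : ∀ x r : ℝ, r ^ 2 = 1 → (x - r) ^ 2 ≤ 1 → x ∈ Set.Icc (-2 : ℝ) 2 := by
    intro x r hr hx
    have h1 := abs_le_one_iff_mul_self_le_one.2 (by rwa [← pow_two] : (x - r) * (x - r) ≤ 1)
    have h2 := abs_le_one_iff_mul_self_le_one.2 (by rw [← pow_two, hr] : r * r ≤ 1)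
    rw [abs_le] at h1 h2
    constructor <;> linarith
  have aux' : ∀ x : ℝ, x ^ 2 ≤ 1 → x ∈ Set.Icc (-2 : ℝ) 2 := by
    intro x hx
    have h1 := abs_le_one_iff_mul_self_le_one.2 (by rwa [← pow_two] : x * x ≤ 1)
    rw [abs_le] at h1
    constructor <;> linarith
  have key : ∀ r : ℝ, r ^ 2 = 1 →
      (A 0 0 - r) ^ 2 + A 0 1 ^ 2 + A 1 0 ^ 2 + (A 1 1 - r) ^ 2 ≤ 1 →
      ∀ i j, A i j ∈ Set.Icc (-2 : ℝ) 2 := by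
    intro r hr h
    have h1 := sq_nonneg (A 0 0 - r)
    have h2 := sq_nonneg (A 0 1)
    have h3 := sq_nonneg (A 1 0)
    have h4 := sq_nonneg (A 1 1 - r)
    simp only [Fin.forall_fin_two]
    exact ⟨⟨aux _ r hr (by linarith), aux' _ (by linarith)⟩,
      aux' _ (by linarith), aux _ r hr (by linarith)⟩
  suffices h : ∀ i j, A i j ∈ Set.Icc (-2 : ℝ) 2 from fun i _ j _ => h i j
  -- If the product is at most `1`, one factor is, and then every entry is within `1` of `0` or
  -- `±1`.
  by_cases h : (A 0 0 - 1) ^ 2 + A 0 1 ^ 2 + A 1 0 ^ 2 + (A 1 1 - 1) ^ 2 ≤ 1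
  · exact key 1 (by norm_num) h
  · refine key (-1) (by norm_num) ?_
    simp only [sub_neg_eq_add]
    by_contra h'
    exact absurd hA (not_le.2 (one_lt_mul_of_lt_of_le (not_le.1 h) (not_le.1 h').le))

theorem gaugeSL_mul_center (A : SL(2, ℝ)) {Z : SL(2, ℝ)} (hZ : Z ∈ Subgroup.center SL(2, ℝ)) :
    gaugeSL (A * Z) = gaugeSL A := by
  obtain ⟨r, hr, hZ⟩ := Matrix.SpecialLinearGroup.mem_center_iff.1 hZ
  have hr : r ^ 2 = 1 := by simpa using hr
  have h : ((A * Z : SL(2, ℝ)) : Matrix (Fin 2) (Fin 2) ℝ) =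
      r • (A : Matrix (Fin 2) (Fin 2) ℝ) := by
    rw [Matrix.SpecialLinearGroup.coe_mul, ← hZ, scalar_apply, ← smul_one_eq_diagonal,
      Matrix.mul_smul, Matrix.mul_one]
  rw [gaugeSL, gaugeSL, h, transpose_smul, Matrix.smul_mul, Matrix.mul_smul, smul_smul, trace_smul,
    trace_smul, ← pow_two, hr, one_smul, smul_eq_mul, mul_pow, hr, one_mul]

theorem gaugeSL_conj (A : SL(2, ℝ)) {k : SL(2, ℝ)}
    (hk : (k : Matrix (Fin 2) (Fin 2) ℝ) * (k : Matrix (Fin 2) (Fin 2) ℝ)ᵀ = 1) :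
    gaugeSL (k * A * k⁻¹) = gaugeSL A := by
  obtain ⟨M, hM⟩ : ∃ M, M = (k : Matrix (Fin 2) (Fin 2) ℝ) := ⟨_, rfl⟩
  rw [← hM] at hk
  have hinv : ((k⁻¹ : SL(2, ℝ)) : Matrix (Fin 2) (Fin 2) ℝ) = Mᵀ := by
    refine left_inv_eq_right_inv (a := M) ?_ hk
    rw [hM, ← Matrix.SpecialLinearGroup.coe_mul, inv_mul_cancel, Matrix.SpecialLinearGroup.coe_one]
  have hk' : Mᵀ * M = 1 := mul_eq_one_comm.1 hk
  have h1 : ∀ B : Matrix (Fin 2) (Fin 2) ℝ, trace (M * B * Mᵀ) = trace B := by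
    intro B
    rw [trace_mul_comm, ← Matrix.mul_assoc, hk', Matrix.one_mul]
  have h2 : ∀ B : Matrix (Fin 2) (Fin 2) ℝ, M * B * Mᵀ * (M * B * Mᵀ)ᵀ = M * (B * Bᵀ) * Mᵀ := by
    intro B
    simp only [transpose_mul, transpose_transpose, Matrix.mul_assoc]
    rw [← Matrix.mul_assoc Mᵀ M, hk', Matrix.one_mul]
  rw [gaugeSL, gaugeSL, Matrix.SpecialLinearGroup.coe_mul, Matrix.SpecialLinearGroup.coe_mul, hinv,
    ← hM, h2, h1, h1]

/-- The function on `PSL₂(ℝ)` induced by `gaugeSL`. -/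
def gaugePSL : PSL(2, ℝ) → ℝ :=
  Quotient.lift gaugeSL fun A B h => by
    have h1 : A⁻¹ * B ∈ Subgroup.center SL(2, ℝ) := QuotientGroup.leftRel_apply.1 h
    rw [← gaugeSL_mul_center A h1, mul_inv_cancel_left]

theorem gaugePSL_mk (A : SL(2, ℝ)) :
    gaugePSL (QuotientGroup.mk' (Subgroup.center SL(2, ℝ)) A) = gaugeSL A := rfl

theorem isConjGauge_gaugePSL : IsConjGauge PSO2 gaugePSL where
  continuous := continuous_gaugeSL.quotient_lift _
  map_one := by
    change gaugeSL 1 = 0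
    simp [gaugeSL_eq]
  pos := by
    intro g hg
    obtain ⟨A, rfl⟩ := QuotientGroup.mk'_surjective _ g
    by_contra h
    rw [gaugePSL_mk, not_lt] at h
    exact hg ((QuotientGroup.eq_one_iff A).2 (mem_center_of_gaugeSL_nonpos h))
  compact := by
    have h : {g | gaugePSL g ≤ 1} =
        QuotientGroup.mk' (Subgroup.center SL(2, ℝ)) '' {A | gaugeSL A ≤ 1} := by
      ext g
      constructor
      · intro hg
        obtain ⟨A, rfl⟩ := QuotientGroup.mk'_surjective _ g
        exact ⟨A, hg, rfl⟩
      · rintro ⟨A, hA, rfl⟩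
        exact hA
    rw [h]
    exact isCompact_gaugeSL_le.image continuous_quotient_mk'
  conj := by
    rintro _ ⟨k, hk, rfl⟩ g
    obtain ⟨A, rfl⟩ := QuotientGroup.mk'_surjective _ g
    rw [← map_inv, ← map_mul, ← map_mul, gaugePSL_mk, gaugePSL_mk]
    exact gaugeSL_conj A hk

end ProjectiveSpecialLinear

end MultRep


end

open MultRep in
theorem proposition1p3 (Γ Γ' : Subgroup PSL(2, ℝ)) [IsCocompactLattice Γ] [IsCocompactLattice Γ']
    (Φ : L2 Γ ≃ₗᵢ[ℂ] L2 Γ') (hΦ : IsMultRepIso Φ) :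
    ∃! q : PSL(2, ℝ) ⧸ Γ, ∀ g : PSL(2, ℝ), (g : PSL(2, ℝ) ⧸ Γ) = q →
      ∃ hg : Γ' = Γ.map (MulAut.conj g).toMonoidHom,
        ∀ f : L2 Γ, Φ f =ᵐ[haarProb Γ'] fun x => f (RightQuotient.leftMulInv g hg x) := by
  obtain ⟨g, hg, h⟩ := exists_leftTranslation isConjGauge_gaugePSL hΦ.map_rep hΦ.map_mul
  refine ⟨g, fun g' hg' => leftTranslation_of_coe_eq hg hg' h, fun q hq => ?_⟩
  obtain ⟨g', rfl⟩ := QuotientGroup.mk_surjective q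
  obtain ⟨hg', h'⟩ := hq g' rfl
  exact leftTranslation_unique hg' hg h' h
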